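/- A \emph{circulation} on a topological space $X$ assigns to each open set $U\subseteq X$ a preorder $\leqslant_U$ on $U$ such that for every collection $\mathcal O$ of open sets, $\leqslant_{\bigcup\mathcal O}$ is the smallest preorder on $\bigcup\mathcal O$ whose graph contains the graphs of all $\leqslant_U$, $U\in\mathcal O$. It is a \emph{k-circulation} if, for every open $U$ and all $x\leqslant_U y$, there are a compact Hausdorff subspace $K\subseteq U$ containing $x,y$ and a circulation $\leqslant'$ on $K$ with $x\leqslant'_K y$ and $\mathrm{graph}(\leqslant'_{K\cap V})\subseteq\mathrm{graph}(\leqslant_V)$ for every open $V\subseteq X$. A \emph{stream} is a weak Hausdorff k-space equipped with a k-circulation. A \emph{stream map} $f:X\to Y$ is a continuous function such that $f(x)\leqslant_U f(x')$ whenever $U\subseteq Y$ is open and $x\leqslant_{f^{-1}U}x'$. Let $\mathscr S$ be the category of streams and stream maps. Order the topological simplex $|\Delta[n]|=\{t\in[0,1]^{n+1}:\sum_i t_i=1\}$ by $s\leqslant t$ iff $\sum_{i\ge j}s_i\le\sum_{i\ge j}t_i$ for all $j$; this is a topological lattice, whose join and meet are the geometric realizations of the join and meet of the ordinal $[n]=\{0<\dots<n\}$.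 Equip $|\Delta[n]|$ with the largest circulation whose preorder on the whole space $|\Delta[n]|$ is contained in this order. For a simplicial set $B$, the \emph{stream realization} of $B$ is the geometric realization $|B|$ equipped with the smallest circulation for which the map $|\Delta[n]|\to|B|$ defined by each simplex of $B$ is monotone over every open subset of $|B|$. This is the stream obtained from the streams $|\Delta[n]|$ by the colimit in $\mathscr S$ over the simplices of $B$, and a simplicial map $\psi$ is sent to the stream map given by $|\psi|$. \textbf{Theorem.} The stream realization functor from simplicial sets to $\mathscr S$ preserves finite products: for all simplicial sets $B_1,\dots,B_k$ ($k\ge 0$), the stream realization of $B_1\times\dots\times B_k$, with the maps induced by the projections, is the product of the stream realizations of $B_1,\dots,B_k$ in $\mathscr S$. -/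

import Mathlib

open CategoryTheory TopologicalSpace Opposite

universe u v w

/-- A circulation on a space `X`: a preorder `rel U` on each open subset `U` of `X`, such that for
each collection `O` of open subsets the preorder on `⋃ O` is the one with smallest graph
containing the graphs of the preorders on the members of `O` (i.e. two points of `⋃ O` are related
exactly when they are joined by a finite chain of relations in members of `O`). -/
structure Circulation (X : Type u) [TopologicalSpace X] where
  rel : Opens X → X → X → Prop
  mem : ∀ {U : Opens X} {x y : X}, rel U x y → x ∈ U ∧ y ∈ U
  refl : ∀ {U : Opens X} {x : X}, x ∈ U → rel U x x
  trans : ∀ {U : Opens X} {x y z : X}, rel U x y → rel U y z → rel U x z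
  rel_sSup : ∀ (O : Set (Opens X)) (x y : X), rel (sSup O) x y ↔
    x ∈ sSup O ∧ Relation.ReflTransGen (fun a b => ∃ U ∈ O, rel U a b) x y

namespace Circulation

variable {X : Type u} [TopologicalSpace X]

lemma rel_mono (c : Circulation X) {U V : Opens X} (h : U ≤ V) {x y : X} (hxy : c.rel U x y) :
    c.rel V x y := by
  have hV : V = sSup {U, V} := by simp [h]
  rw [hV, c.rel_sSup, ← hV]
  exact ⟨h (c.mem hxy).1, .single ⟨U, by simp, hxy⟩⟩

/-- The circulation generated by a family of relations. -/
def generate (R : Opens X → X → X → Prop)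
    (mem : ∀ {U : Opens X} {x y : X}, R U x y → x ∈ U ∧ y ∈ U)
    (mono : ∀ {U V : Opens X} {x y : X}, U ≤ V → R U x y → R V x y)
    (glue : ∀ (O : Set (Opens X)) (x y : X), R (sSup O) x y →
      Relation.ReflTransGen (fun a b => ∃ U ∈ O, R U a b) x y) : Circulation X where
  rel U x y := x ∈ U ∧ Relation.ReflTransGen (R U) x y
  mem := by
    rintro U x y ⟨hx, h⟩
    refine ⟨hx, ?_⟩
    induction h with
    | refl => exact hx
    | tail _ h _ => exact (mem h).2
  refl hx := ⟨hx, .refl⟩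
  trans h h' := ⟨h.1, h.2.trans h'.2⟩
  rel_sSup O x y := by
    refine and_congr_right fun hx => ⟨fun h => ?_, fun h => ?_⟩
    · induction h with
      | refl => exact .refl
      | tail _ h ih =>
        refine ih.trans (Relation.ReflTransGen.mono ?_ _ _ (glue O _ _ h))
        rintro a b ⟨U, hU, hab⟩
        exact ⟨U, hU, (mem hab).1, .single hab⟩
    · induction h with
      | refl => exact .refl
      | tail _ h ih =>
        obtain ⟨U, hU, _, h⟩ := h
        exact ih.trans (Relation.ReflTransGen.mono (fun a b hab => mono (le_sSup hU) hab) _ _ h)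

/-- The final circulation along a family of continuous maps `f i : Y i → X`: the smallest
circulation on `X` for which `f i y ≤_U f i y'` whenever `y ≤ y'` on `(f i)⁻¹ U`. -/
def final {ι : Type w} {Y : ι → Type v} [∀ i, TopologicalSpace (Y i)]
    (c : ∀ i, Circulation (Y i)) (f : ∀ i, C(Y i, X)) : Circulation X :=
  generate (fun U a b => ∃ i p q, (c i).rel (U.comap (f i)) p q ∧ f i p = a ∧ f i q = b)
    (by
      rintro U _ _ ⟨i, p, q, h, rfl, rfl⟩
      exact (c i).mem h)
    (by
      rintro U V _ _ hUV ⟨i, p, q, h, rfl, rfl⟩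
      exact ⟨i, p, q, (c i).rel_mono (fun z hz => hUV hz) h, rfl, rfl⟩)
    (by
      rintro O _ _ ⟨i, p, q, h, rfl, rfl⟩
      have hO : (sSup O).comap (f i) = sSup ((Opens.comap (f i)) '' O) := by
        ext z; simp
      rw [hO, (c i).rel_sSup] at h
      refine h.2.lift (f i) ?_
      rintro a b ⟨_, ⟨U, hU, rfl⟩, hab⟩
      exact ⟨U, hU, i, a, b, hab, rfl, rfl⟩)

lemma rel_final {ι : Type w} {Y : ι → Type v} [∀ i, TopologicalSpace (Y i)]
    (c : ∀ i, Circulation (Y i)) (f : ∀ i, C(Y i, X)) (U : Opens X) (x y : X) :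
    (final c f).rel U x y ↔ x ∈ U ∧ Relation.ReflTransGen
      (fun a b => ∃ i p q, (c i).rel (U.comap (f i)) p q ∧ f i p = a ∧ f i q = b) x y :=
  Iff.rfl

lemma final_step {ι : Type w} {Y : ι → Type v} [∀ i, TopologicalSpace (Y i)]
    (c : ∀ i, Circulation (Y i)) (f : ∀ i, C(Y i, X)) {U : Opens X} (i : ι) {p q : Y i}
    (h : (c i).rel (U.comap (f i)) p q) : (final c f).rel U (f i p) (f i q) :=
  ⟨((c i).mem h).1, .single ⟨i, p, q, h, rfl, rfl⟩⟩

/-- The circulation of a space with a global preorder `r`: the largest circulation whose preorder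
on the whole space is contained in `r`. -/
def ofPreorder (r : X → X → Prop) : Circulation X :=
  final (ι := {c : Circulation X // ∀ x y, c.rel ⊤ x y → r x y}) (fun c => c.1)
    (fun _ => ContinuousMap.id X)

lemma rel_ofPreorder (r : X → X → Prop) (hr : ∀ x, r x x)
    (ht : ∀ x y z, r x y → r y z → r x z) {x y : X} (h : (ofPreorder r).rel ⊤ x y) : r x y := by
  obtain ⟨-, h⟩ := h
  induction h with
  | refl => exact hr _
  | tail _ h ih =>
    obtain ⟨c, p, q, h, rfl, rfl⟩ := h
    exact ht _ _ _ ih (c.2 _ _ h)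

lemma le_ofPreorder (r : X → X → Prop) (c : Circulation X) (hc : ∀ x y, c.rel ⊤ x y → r x y)
    {U : Opens X} {x y : X} (h : c.rel U x y) : (ofPreorder r).rel U x y :=
  final_step (ι := {c : Circulation X // ∀ x y, c.rel ⊤ x y → r x y}) (fun c => c.1)
    (fun _ => ContinuousMap.id X) ⟨c, hc⟩ h

/-- `x ≤_U y` is witnessed by a circulation on a compact Hausdorff subspace `K ⊆ U`. -/
def CompactlyRelated (c : Circulation X) (U : Opens X) (x y : X) : Prop :=
  ∃ (K : Set X) (_ : IsCompact K) (_ : T2Space K) (_ : K ⊆ U) (hx : x ∈ K) (hy : y ∈ K)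
    (d : Circulation K), d.rel ⊤ ⟨x, hx⟩ ⟨y, hy⟩ ∧
      ∀ (V : Opens X) (a b : K), d.rel (V.comap ⟨Subtype.val, continuous_subtype_val⟩) a b →
        c.rel V a b

/-- A k-circulation: every relation is witnessed on a compact Hausdorff subspace. -/
def IsKCirculation (c : Circulation X) : Prop :=
  ∀ (U : Opens X) (x y : X), c.rel U x y → c.CompactlyRelated U x y

/-- The defining condition for a continuous map to be a stream map. -/
def IsStreamMap {Y : Type v} [TopologicalSpace Y] (c : Circulation X) (d : Circulation Y)
    (f : C(X, Y)) : Prop :=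
  ∀ (U : Opens Y) (x x' : X), c.rel (U.comap f) x x' → d.rel U (f x) (f x')

lemma IsStreamMap.of_final {ι : Type w} {Y : ι → Type v} [∀ i, TopologicalSpace (Y i)]
    (c : ∀ i, Circulation (Y i)) (f : ∀ i, C(Y i, X)) {Z : Type*} [TopologicalSpace Z]
    (d : Circulation Z) (g : C(X, Z)) (h : ∀ i, IsStreamMap (c i) d (g.comp (f i))) :
    IsStreamMap (final c f) d g := by
  rintro U x y ⟨hx, hxy⟩
  induction hxy with
  | refl => exact d.refl hx
  | tail _ h' ih =>
    obtain ⟨i, p, q, h', rfl, rfl⟩ := h'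
    exact d.trans ih (h i U p q h')

lemma IsStreamMap.comp {Y : Type v} [TopologicalSpace Y] {Z : Type*} [TopologicalSpace Z]
    {c : Circulation X} {d : Circulation Y} {e : Circulation Z} {g : C(Y, Z)} {f : C(X, Y)}
    (hg : IsStreamMap d e g) (hf : IsStreamMap c d f) : IsStreamMap c e (g.comp f) :=
  fun U x x' h => hg U _ _ (hf (U.comap g) x x' h)

lemma IsStreamMap.comp_final {ι : Type w} {Y : ι → Type v} [∀ i, TopologicalSpace (Y i)]
    (c : ∀ i, Circulation (Y i)) (f : ∀ i, C(Y i, X)) (i : ι) :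
    IsStreamMap (c i) (final c f) (f i) :=
  fun _ _ _ h => final_step c f i h

/-- Continuous monotone maps are stream maps. -/
lemma isStreamMap_ofPreorder {Y : Type v} [TopologicalSpace Y] {r : X → X → Prop}
    {s : Y → Y → Prop} (hr : ∀ x, r x x) (hrt : ∀ x y z, r x y → r y z → r x z)
    (hs : ∀ x, s x x) (hst : ∀ x y z, s x y → s y z → s x z) (f : C(X, Y))
    (hf : ∀ x y, r x y → s (f x) (f y)) : IsStreamMap (ofPreorder r) (ofPreorder s) f := by
  intro U x y h
  refine le_ofPreorder s (final (ι := Unit) (fun _ => ofPreorder r) (fun _ => f)) ?_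
    (final_step (ι := Unit) (fun _ => ofPreorder r) (fun _ => f) () h)
  rintro a b ⟨-, hab⟩
  induction hab with
  | refl => exact hs _
  | tail _ h ih =>
    obtain ⟨i, p, q, h, rfl, rfl⟩ := h
    exact hst _ _ _ ih (hf _ _ (rel_ofPreorder r hr hrt h))

section K

lemma CompactlyRelated.refl (c : Circulation X) {U : Opens X} {x : X} (hx : x ∈ U) :
    c.CompactlyRelated U x x := by
  refine ⟨{x}, isCompact_singleton, inferInstance, by simpa using hx, rfl, rfl,
    final (ι := Empty) (Y := fun _ => X) (fun e => e.elim) (fun e => e.elim),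
    Circulation.refl _ trivial, ?_⟩
  rintro V a b h
  have ha : a = b := Subsingleton.elim _ _
  subst ha
  exact c.refl (Circulation.mem _ h).1

lemma CompactlyRelated.trans [T2Space X] (c : Circulation X) {U : Opens X} {x y z : X}
    (h : c.CompactlyRelated U x y) (h' : c.CompactlyRelated U y z) : c.CompactlyRelated U x z := by
  obtain ⟨K, hK, _, hKU, hx, hy, d, hd, hd'⟩ := h
  obtain ⟨L, hL, _, hLU, hy', hz, e, he, he'⟩ := h'
  let i : C(K, ↥(K ∪ L)) := ⟨Set.inclusion Set.subset_union_left, continuous_inclusion _⟩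
  let j : C(L, ↥(K ∪ L)) := ⟨Set.inclusion Set.subset_union_right, continuous_inclusion _⟩
  let d' := final (ι := Unit) (fun _ => d) (fun _ => i)
  let e' := final (ι := Unit) (fun _ => e) (fun _ => j)
  let f : Circulation ↥(K ∪ L) := final (ι := Bool) (Y := fun _ => ↥(K ∪ L))
    (fun t => bif t then d' else e') (fun _ => ContinuousMap.id _)
  refine ⟨K ∪ L, hK.union hL, inferInstance, Set.union_subset hKU hLU, .inl hx, .inr hz, f, ?_, ?_⟩
  · refine f.trans (y := ⟨y, .inl hy⟩) ?_ ?_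
    · exact final_step (ι := Bool) (Y := fun _ => ↥(K ∪ L)) (fun t => bif t then d' else e')
        (fun _ => ContinuousMap.id _) (U := ⊤) true
        (final_step (ι := Unit) (fun _ => d) (fun _ => i) (U := ⊤) () hd)
    · exact final_step (ι := Bool) (Y := fun _ => ↥(K ∪ L)) (fun t => bif t then d' else e')
        (fun _ => ContinuousMap.id _) (U := ⊤) false
        (final_step (ι := Unit) (fun _ => e) (fun _ => j) (U := ⊤) () he)
  · refine IsStreamMap.of_final _ _ c ⟨Subtype.val, continuous_subtype_val⟩ ?_
    rintro (_ | _)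
    · exact IsStreamMap.of_final (ι := Unit) _ _ c _ fun _ V a b h => he' V a b h
    · exact IsStreamMap.of_final (ι := Unit) _ _ c _ fun _ V a b h => hd' V a b h

lemma CompactlyRelated.map [T2Space X] {Y : Type v} [TopologicalSpace Y] {d : Circulation Y}
    {c : Circulation X} {f : C(Y, X)} (hf : IsStreamMap d c f) {U : Opens X} {x y : Y}
    (h : d.CompactlyRelated (U.comap f) x y) : c.CompactlyRelated U (f x) (f y) := by
  obtain ⟨K, hK, _, hKU, hx, hy, e, he, he'⟩ := h
  let g : C(K, ↥(f '' K)) := ⟨fun k => ⟨f k, k, k.2, rfl⟩, by fun_prop⟩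
  refine ⟨f '' K, hK.image f.continuous, inferInstance, ?_, ⟨x, hx, rfl⟩, ⟨y, hy, rfl⟩,
    final (ι := Unit) (fun _ => e) (fun _ => g),
    final_step (ι := Unit) (fun _ => e) (fun _ => g) (U := ⊤) () he, ?_⟩
  · rintro _ ⟨k, hk, rfl⟩
    exact hKU hk
  · refine IsStreamMap.of_final (ι := Unit) _ _ c ⟨Subtype.val, continuous_subtype_val⟩ ?_
    exact fun _ V a b h => hf V _ _ (he' (V.comap f) a b h)

lemma isKCirculation_final [T2Space X] {ι : Type w} {Y : ι → Type v}
    [∀ i, TopologicalSpace (Y i)] (c : ∀ i, Circulation (Y i)) (f : ∀ i, C(Y i, X))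
    (h : ∀ i, (c i).IsKCirculation) : (final c f).IsKCirculation := by
  rintro U x y ⟨hx, hxy⟩
  induction hxy with
  | refl => exact .refl _ hx
  | tail _ h' ih =>
    obtain ⟨i, p, q, h', rfl, rfl⟩ := h'
    exact ih.trans _ ((h i _ _ _ h').map (IsStreamMap.comp_final c f i))

lemma isKCirculation_of_locallyCompact [LocallyCompactSpace X] [T2Space X] (c : Circulation X) :
    c.IsKCirculation := by
  intro U x y h
  have hU : U = sSup {V : Opens X | ∃ K : Set X, IsCompact K ∧ (V : Set X) ⊆ K ∧ K ⊆ U} := by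
    refine le_antisymm (fun z hz => ?_) (sSup_le ?_)
    · obtain ⟨K, hK, hzK, hKU⟩ := exists_compact_subset U.isOpen hz
      rw [Opens.mem_sSup]
      exact ⟨⟨interior K, isOpen_interior⟩, ⟨K, hK, interior_subset, hKU⟩, hzK⟩
    · rintro V ⟨K, -, hVK, hKU⟩
      exact hVK.trans hKU
  have hx := (c.mem h).1
  rw [hU, c.rel_sSup] at h
  obtain ⟨-, h⟩ := h
  induction h with
  | refl => exact .refl _ hx
  | @tail a b _ h ih =>
    refine ih.trans _ ?_
    obtain ⟨V, ⟨K, hK, hVK, hKU⟩, hab⟩ := h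
    let op (W : Opens K) : Opens X := ⟨V ∩ {z | ∃ h : z ∈ K, (⟨z, h⟩ : K) ∈ W}, by
      obtain ⟨W, hW⟩ := W
      obtain ⟨W', hW', rfl⟩ := isOpen_induced_iff.1 hW
      convert V.isOpen.inter hW' using 1
      ext z
      exact ⟨fun ⟨h1, _, h2⟩ => ⟨h1, h2⟩, fun ⟨h1, h2⟩ => ⟨h1, hVK h1, h2⟩⟩⟩
    have hop : ∀ (W : Opens K) (p : K), (p : X) ∈ op W → p ∈ W := fun W p hp => hp.2.2
    let d : Circulation K := generate (fun W p q => c.rel (op W) p q)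
      (fun h => ⟨hop _ _ (c.mem h).1, hop _ _ (c.mem h).2⟩)
      (fun {U V} _ _ hUV h => c.rel_mono
        (show op U ≤ op V from fun z hz => ⟨hz.1, hz.2.1, hUV hz.2.2⟩) h)
      (by
        intro O p q h
        have hO : op (sSup O) = sSup (op '' O) := by
          ext z
          simp only [op, Opens.coe_sSup, SetLike.mem_coe, Opens.mem_mk, Set.mem_inter_iff,
            Set.mem_ofPred_eq, Opens.mem_sSup, Set.mem_iUnion, Set.mem_image, exists_prop,
            exists_exists_and_eq_and]
          constructor
          · rintro ⟨h1, h2, W, hW, h3⟩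
            exact ⟨W, hW, h1, h2, h3⟩
          · rintro ⟨W, hW, h1, h2, h3⟩
            exact ⟨h1, h2, W, hW, h3⟩
        rw [hO, c.rel_sSup] at h
        obtain ⟨-, h⟩ := h
        have key : ∀ z : X, Relation.ReflTransGen (fun a b => ∃ U ∈ op '' O, c.rel U a b) p z →
            ∃ hz : z ∈ K, Relation.ReflTransGen
              (fun a b : K => ∃ U ∈ O, c.rel (op U) a b) p ⟨z, hz⟩ := by
          intro z hz
          induction hz with
          | refl => exact ⟨p.2, .refl⟩
          | tail _ h ih =>
            obtain ⟨_, ⟨W, hW, rfl⟩, h⟩ := h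
            obtain ⟨h0, ih⟩ := ih
            exact ⟨(c.mem h).2.2.1, ih.tail ⟨W, hW, h⟩⟩
        exact (key _ h).2)
    refine ⟨K, hK, inferInstance, hKU, hVK (c.mem hab).1, hVK (c.mem hab).2, d,
      ⟨trivial, .single ?_⟩, ?_⟩
    · exact c.rel_mono (show V ≤ op ⊤ from fun z hz => ⟨hz, hVK hz, trivial⟩) hab
    · rintro W p q ⟨hp, h⟩
      induction h with
      | refl => exact c.refl hp
      | tail _ h ih => exact c.trans ih (c.rel_mono (show op (W.comap ⟨Subtype.val, continuous_subtype_val⟩) ≤ W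
          from fun z hz => hz.2.2) h)

end K

end Circulation

/-- A weak Hausdorff space: continuous images of compact Hausdorff spaces are closed. -/
class WeakHausdorffSpace (X : Type u) [TopologicalSpace X] : Prop where
  isClosed_range : ∀ (K : Type u) [TopologicalSpace K] [CompactSpace K] [T2Space K] (f : K → X),
    Continuous f → IsClosed (Set.range f)

instance (X : Type u) [TopologicalSpace X] [T2Space X] : WeakHausdorffSpace X where
  isClosed_range _ _ _ _ _ hf := (isCompact_range hf).isClosed

/-- A stream: a weak Hausdorff k-space equipped with a k-circulation. -/
structure StreamCat : Type (u + 1) where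
  carrier : Type u
  [topologicalSpace : TopologicalSpace carrier]
  [compactlyGenerated : CompactlyGeneratedSpace carrier]
  [weakHausdorff : WeakHausdorffSpace carrier]
  circulation : Circulation carrier
  isKCirculation : circulation.IsKCirculation

namespace StreamCat

attribute [instance] topologicalSpace compactlyGenerated weakHausdorff

/-- A stream map: a continuous function `f` such that `f x ≤_U f x'` whenever
`x ≤ x'` on `f⁻¹ U`. -/
@[ext]
structure Hom (X Y : StreamCat.{u}) where
  toContinuousMap : C(X.carrier, Y.carrier)
  isStreamMap : Circulation.IsStreamMap X.circulation Y.circulation toContinuousMap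

/-- The category of streams and stream maps. -/
instance : Category StreamCat.{u} where
  Hom := Hom
  id X := ⟨ContinuousMap.id _, fun _ _ _ h => h⟩
  comp f g := ⟨g.toContinuousMap.comp f.toContinuousMap, g.isStreamMap.comp f.isStreamMap⟩

end StreamCat

section Simplex

/-- The sum of the barycentric coordinates of `x` at the vertices `j, j + 1, …, n`. -/
noncomputable def simplexTail {n : ℕ} (x : stdSimplex ℝ (Fin (n + 1))) (j : Fin (n + 1)) : ℝ :=
  ∑ i ∈ Finset.Ici j, x i

/-- The lattice order on the topological `n`-simplex. Its binary joins and meets (pointwise maxima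
and minima of `simplexTail`) are the realizations of the joins and meets of the
ordinal `{0 < ⋯ < n}`; see `simplexTail_map_sup` and `simplexTail_map_inf`. -/
def simplexLE {n : ℕ} (x y : stdSimplex ℝ (Fin (n + 1))) : Prop :=
  ∀ j, simplexTail x j ≤ simplexTail y j

lemma simplexTail_map {k n : ℕ} (a : Fin (k + 1) → Fin (n + 1))
    (w : stdSimplex ℝ (Fin (k + 1))) (j : Fin (n + 1)) :
    simplexTail (stdSimplex.map a w) j = ∑ i with j ≤ a i, w i := by
  classical
  simp only [simplexTail, stdSimplex.map_coe, FunOnFinite.linearMap_apply_apply]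
  rw [← Finset.sum_fiberwise_of_maps_to (s := Finset.univ.filter fun i => j ≤ a i)
    (t := Finset.Ici j) (g := a) (by simp)]
  refine Finset.sum_congr rfl fun i hi => Finset.sum_congr ?_ fun _ _ => rfl
  ext l
  simp only [Finset.mem_Ici, Finset.mem_filter, Finset.mem_univ, true_and] at hi ⊢
  exact ⟨fun h => ⟨h ▸ hi, h⟩, fun h => h.2⟩

lemma filter_le_or {k n : ℕ} (a b : Fin (k + 1) →o Fin (n + 1)) (j : Fin (n + 1)) :
    (∀ i, j ≤ a i → j ≤ b i) ∨ (∀ i, j ≤ b i → j ≤ a i) := by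
  by_contra! h
  obtain ⟨⟨i, hi, hi'⟩, ⟨l, hl, hl'⟩⟩ := h
  rcases le_total i l with h | h
  · exact absurd (hi.trans (a.monotone h)) (not_le.2 hl')
  · exact absurd (hl.trans (b.monotone h)) (not_le.2 hi')

lemma simplexTail_map_mono {k n : ℕ} (a b : Fin (k + 1) → Fin (n + 1)) (j : Fin (n + 1))
    (h : ∀ i, j ≤ a i → j ≤ b i) (w : stdSimplex ℝ (Fin (k + 1))) :
    simplexTail (stdSimplex.map a w) j ≤ simplexTail (stdSimplex.map b w) j := by
  rw [simplexTail_map, simplexTail_map]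
  refine Finset.sum_le_sum_of_subset_of_nonneg (fun i => ?_) fun i _ _ => w.2.1 i
  simpa using h i

/-- Under the homeomorphism of `|Δ[n] × Δ[n]|` with `|Δ[n]|²`, every pair of points of the simplex
is of the form `(stdSimplex.map a w, stdSimplex.map b w)`; the realization of the join operation
sends it to `stdSimplex.map (a ⊔ b) w`. -/
lemma simplexTail_map_sup {k n : ℕ} (a b : Fin (k + 1) →o Fin (n + 1))
    (w : stdSimplex ℝ (Fin (k + 1))) (j : Fin (n + 1)) :
    simplexTail (stdSimplex.map (a ⊔ b : Fin (k + 1) →o Fin (n + 1)) w) j =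
      max (simplexTail (stdSimplex.map a w) j) (simplexTail (stdSimplex.map b w) j) := by
  rcases filter_le_or a b j with h | h
  · rw [max_eq_right (simplexTail_map_mono _ _ _ h w), simplexTail_map, simplexTail_map]
    refine Finset.sum_congr (Finset.filter_congr fun i _ => ?_) fun _ _ => rfl
    have := h i
    simp only [OrderHom.coe_sup, Pi.sup_apply, le_sup_iff]
    tauto
  · rw [max_eq_left (simplexTail_map_mono _ _ _ h w), simplexTail_map, simplexTail_map]
    refine Finset.sum_congr (Finset.filter_congr fun i _ => ?_) fun _ _ => rfl
    have := h i
    simp only [OrderHom.coe_sup, Pi.sup_apply, le_sup_iff]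
    tauto

lemma simplexTail_map_inf {k n : ℕ} (a b : Fin (k + 1) →o Fin (n + 1))
    (w : stdSimplex ℝ (Fin (k + 1))) (j : Fin (n + 1)) :
    simplexTail (stdSimplex.map (a ⊓ b : Fin (k + 1) →o Fin (n + 1)) w) j =
      min (simplexTail (stdSimplex.map a w) j) (simplexTail (stdSimplex.map b w) j) := by
  rcases filter_le_or a b j with h | h
  · rw [min_eq_left (simplexTail_map_mono _ _ _ h w), simplexTail_map, simplexTail_map]
    refine Finset.sum_congr (Finset.filter_congr fun i _ => ?_) fun _ _ => rfl
    have := h i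
    simp only [OrderHom.coe_inf, Pi.inf_apply, le_inf_iff]
    tauto
  · rw [min_eq_right (simplexTail_map_mono _ _ _ h w), simplexTail_map, simplexTail_map]
    refine Finset.sum_congr (Finset.filter_congr fun i _ => ?_) fun _ _ => rfl
    have := h i
    simp only [OrderHom.coe_inf, Pi.inf_apply, le_inf_iff]
    tauto

/-- The circulation of the topological simplex, regarded as a compact connected Hausdorff
topological lattice: the largest circulation compatible with the lattice order. (A compact ordered
space with closed order has at most one circulation whose preorder on the whole space is the
given order; for the simplex it exists, and is then this one.) -/
noncomputable def simplexCirculation (n : SimplexCategory) :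
    Circulation (SimplexCategory.toTop.{u}.obj n) :=
  Circulation.ofPreorder fun x y => simplexLE x.down y.down

instance (n : SimplexCategory) : CompactSpace (SimplexCategory.toTop.{u}.obj n) :=
  inferInstanceAs (CompactSpace (ULift.{u} (stdSimplex ℝ (Fin (n.len + 1)))))

instance (n : SimplexCategory) : T2Space (SimplexCategory.toTop.{u}.obj n) :=
  inferInstanceAs (T2Space (ULift.{u} (stdSimplex ℝ (Fin (n.len + 1)))))

lemma isStreamMap_simplex_map {m n : SimplexCategory} (α : m ⟶ n) :
    Circulation.IsStreamMap (simplexCirculation.{u} m) (simplexCirculation n)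
      (SimplexCategory.toTop.map α).hom := by
  refine Circulation.isStreamMap_ofPreorder (fun _ _ => le_rfl)
    (fun _ _ _ h h' j => (h j).trans (h' j)) (fun _ _ => le_rfl)
    (fun _ _ _ h h' j => (h j).trans (h' j)) _ fun x y h j => ?_
  refine (simplexTail_map (k := m.len) (n := n.len) α.toOrderHom x.down j).trans_le
    (le_of_le_of_eq ?_ (simplexTail_map (k := m.len) (n := n.len) α.toOrderHom y.down j).symm)
  by_cases hj : ∃ i, j ≤ α.toOrderHom i
  · classical
    have hi : (Finset.univ.filter fun i => j ≤ α.toOrderHom i) =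
        Finset.Ici ((Finset.univ.filter fun i => j ≤ α.toOrderHom i).min'
          (hj.imp fun i hi => by simpa using hi)) := by
      ext i
      simp only [Finset.mem_filter, Finset.mem_univ, true_and, Finset.mem_Ici]
      refine ⟨fun hi => Finset.min'_le _ _ (by simpa using hi), fun hi => ?_⟩
      have := Finset.min'_mem (Finset.univ.filter fun i => j ≤ α.toOrderHom i)
        (hj.imp fun i hi => by simpa using hi)
      exact (Finset.mem_filter.1 this).2.trans (α.toOrderHom.monotone hi)
    rw [hi]
    exact h _
  · have hi : (Finset.univ.filter fun i => j ≤ α.toOrderHom i) = ∅ := by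
      ext i; simpa using fun hi => hj ⟨i, hi⟩
    rw [hi, Finset.sum_empty, Finset.sum_empty]

lemma simplexCirculation_isKCirculation (n : SimplexCategory) :
    (simplexCirculation.{u} n).IsKCirculation :=
  Circulation.isKCirculation_of_locallyCompact _

end Simplex

namespace Realization

/-- The continuous map `|Δ[n]| → |B|` defined by an `n`-simplex `σ` of `B`. -/
noncomputable def charMap (B : SSet.{u}) {n : SimplexCategory} (σ : B.obj (op n)) :
    SimplexCategory.toTop.{u}.obj n ⟶ SSet.toTop.obj B :=
  SSet.toTopSimplex.inv.app n ≫ SSet.toTop.map (SSet.yonedaEquiv.symm σ)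

lemma charMap_comp_map {B C : SSet.{u}} (f : B ⟶ C) {n : SimplexCategory} (σ : B.obj (op n)) :
    charMap B σ ≫ SSet.toTop.map f = charMap C (f.app _ σ) := by
  rw [charMap, charMap, Category.assoc, ← Functor.map_comp, SSet.yonedaEquiv_symm_comp]

lemma homEquiv_down {B : SSet.{u}} {X : TopCat.{u}} (f : SSet.toTop.obj B ⟶ X)
    {n : SimplexCategory} (σ : B.obj (op n)) :
    ((sSetTopAdj.homEquiv B X f).app (op n) σ).down = charMap B σ ≫ f := by
  rw [Adjunction.homEquiv_unit]
  change ((sSetTopAdj.unit.app B).app (op n) σ).down ≫ f = _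
  rw [sSetTopAdj_unit_app_app_down]
  rfl

lemma toTop_hom_ext {B : SSet.{u}} {X : TopCat.{u}} {f g : SSet.toTop.obj B ⟶ X}
    (h : ∀ (n : SimplexCategory) (σ : B.obj (op n)), charMap B σ ≫ f = charMap B σ ≫ g) :
    f = g := by
  apply (sSetTopAdj.homEquiv B X).injective
  ext n σ
  apply ULift.down_injective
  have := h n.unop σ
  rw [← homEquiv_down, ← homEquiv_down] at this
  exact this

lemma charMap_map (B : SSet.{u}) {m n : SimplexCategory} (α : m ⟶ n) (σ : B.obj (op n)) :
    charMap B (B.map α.op σ) = SimplexCategory.toTop.map α ≫ charMap B σ := by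
  have h := fun τ => homEquiv_down (B := B) (𝟙 _) (n := m) τ
  have h' := fun τ => homEquiv_down (B := B) (𝟙 _) (n := n) τ
  simp only [Category.comp_id] at h h'
  rw [← h, ← h', ← comp_apply, NatTrans.naturality]
  rfl

lemma exists_toTop_desc {B : SSet.{u}} {X : TopCat.{u}}
    (φ : ∀ (n : SimplexCategory), B.obj (op n) → (SimplexCategory.toTop.{u}.obj n ⟶ X))
    (hφ : ∀ {m n : SimplexCategory} (α : m ⟶ n) (σ : B.obj (op n)),
      φ m (B.map α.op σ) = SimplexCategory.toTop.map α ≫ φ n σ) :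
    ∃ f : SSet.toTop.obj B ⟶ X, ∀ (n : SimplexCategory) (σ : B.obj (op n)),
      charMap B σ ≫ f = φ n σ := by
  let F : B ⟶ TopCat.toSSet.obj X :=
    { app := fun n => TypeCat.ofHom fun σ => ULift.up (φ n.unop σ)
      naturality := fun m n α => by
        ext σ
        apply ULift.down_injective
        exact hφ α.unop σ }
  refine ⟨(sSetTopAdj.homEquiv B X).symm F, fun n σ => ?_⟩
  rw [← homEquiv_down, Equiv.apply_symm_apply]
  rfl

lemma charMap_surjective (B : SSet.{u}) (x : SSet.toTop.obj B) :
    ∃ (n : SimplexCategory) (σ : B.obj (op n)) (t : SimplexCategory.toTop.{u}.obj n),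
      charMap B σ t = x := by
  let _ : TopologicalSpace (ULift.{u} Prop) := ⊤
  let f : SSet.toTop.obj B ⟶ TopCat.of (ULift.{u} Prop) := TopCat.ofHom
    ⟨fun x => ULift.up (∃ (n : SimplexCategory) (σ : B.obj (op n))
      (t : SimplexCategory.toTop.{u}.obj n), charMap B σ t = x), continuous_top⟩
  let g : SSet.toTop.obj B ⟶ TopCat.of (ULift.{u} Prop) := TopCat.ofHom
    ⟨fun x => ULift.up True, continuous_top⟩
  have hfg : f = g := by
    refine toTop_hom_ext fun n σ => ?_
    ext t
    exact iff_of_true ⟨n, σ, t, rfl⟩ trivial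
  have := congrArg ULift.down (congrArg (fun h : SSet.toTop.obj B ⟶ TopCat.of (ULift.{u} Prop) =>
    h.hom x) hfg)
  exact of_eq_true this

lemma isOpen_of_charMap (B : SSet.{u}) (s : Set (SSet.toTop.obj B))
    (h : ∀ (n : SimplexCategory) (σ : B.obj (op n)), IsOpen (charMap B σ ⁻¹' s)) : IsOpen s := by
  obtain ⟨f, hf⟩ := exists_toTop_desc (B := B) (X := TopCat.of (ULift.{u} Prop))
    (fun n σ => TopCat.ofHom ⟨fun t => ULift.up (charMap B σ t ∈ s),
      continuous_uliftUp.comp (continuous_Prop.2 (h n σ))⟩) (by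
      intro m n α σ
      ext t
      change charMap B (B.map α.op σ) t ∈ s ↔ _
      rw [charMap_map]
      rfl)
  have hs : {x | (f x).down} = s := by
    ext x
    obtain ⟨n, σ, t, rfl⟩ := charMap_surjective B x
    have := congrArg ULift.down (congrArg
      (fun h : SimplexCategory.toTop.obj n ⟶ TopCat.of (ULift.{u} Prop) => h.hom t) (hf n σ))
    exact iff_of_eq this
  rw [← hs]
  exact continuous_Prop.1 (continuous_uliftDown.comp f.hom.continuous)

instance (B : SSet.{u}) : CompactlyGeneratedSpace (SSet.toTop.obj B) := by
  refine compactlyGeneratedSpace_of_isOpen fun s h => isOpen_of_charMap B s fun n σ => ?_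
  exact h _ _ (charMap B σ).hom.continuous

section Separation

variable {B : SSet.{u}}

/-- The monotone rearrangement of a function between finite ordinals. -/
def sortHom {k n : ℕ} (p : Fin (k + 1) → Fin (n + 1)) :
    SimplexCategory.mk k ⟶ SimplexCategory.mk n :=
  SimplexCategory.mkHom ⟨p ∘ Tuple.sort p, Tuple.monotone_sort p⟩

lemma sortHom_comp {k n m : ℕ} (p : Fin (k + 1) → Fin (n + 1))
    (α : SimplexCategory.mk n ⟶ SimplexCategory.mk m) :
    sortHom (α.toOrderHom ∘ p) = sortHom p ≫ α := by
  ext i : 3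
  have h : (α.toOrderHom ∘ p) ∘ Tuple.sort p = (α.toOrderHom ∘ p) ∘ Tuple.sort (α.toOrderHom ∘ p) :=
    Tuple.comp_sort_eq_comp_iff_monotone.2 (α.toOrderHom.monotone.comp (Tuple.monotone_sort p))
  exact (congrFun h i).symm

lemma sortHom_toOrderHom {k n : ℕ} (g : SimplexCategory.mk k ⟶ SimplexCategory.mk n) :
    sortHom (g.toOrderHom : Fin (k + 1) → Fin (n + 1)) = g := by
  ext i : 3
  have h := Tuple.sort_eq_refl_iff_monotone.2 g.toOrderHom.monotone
  change g.toOrderHom (Tuple.sort (g.toOrderHom : Fin (k + 1) → Fin (n + 1)) i) = _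
  rw [h]
  rfl

open scoped Classical in
/-- The probability that a random monotone sample of `k + 1` vertices, drawn according to the
barycentric coordinates `t`, of the simplex `σ` spans `τ`. -/
noncomputable def weight {k : ℕ} (τ : B.obj (op (.mk k))) {n : ℕ} (σ : B.obj (op (.mk n)))
    (t : stdSimplex ℝ (Fin (n + 1))) : ℝ :=
  ∑ p : Fin (k + 1) → Fin (n + 1), if B.map (sortHom p).op σ = τ then ∏ i, t (p i) else 0

lemma continuous_weight {k : ℕ} (τ : B.obj (op (.mk k))) {n : ℕ} (σ : B.obj (op (.mk n))) :
    Continuous (weight τ σ) := by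
  unfold weight
  refine continuous_finsetSum _ fun p _ => ?_
  split_ifs
  · exact continuous_finsetProd _ fun i _ =>
      (continuous_apply (p i)).comp continuous_subtype_val
  · exact continuous_const

lemma weight_map {k : ℕ} (τ : B.obj (op (.mk k))) {m n : ℕ}
    (α : SimplexCategory.mk m ⟶ SimplexCategory.mk n)
    (σ : B.obj (op (.mk n))) (t : stdSimplex ℝ (Fin (m + 1))) :
    weight τ (B.map α.op σ) t = weight τ σ (stdSimplex.map α.toOrderHom t) := by
  classical
  unfold weight
  rw [← Finset.sum_fiberwise (s := Finset.univ)
    (g := fun p : Fin (k + 1) → Fin (m + 1) => (α.toOrderHom ∘ p : Fin (k + 1) → Fin (n + 1)))]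
  refine Finset.sum_congr rfl fun q _ => ?_
  have h1 : ∀ p ∈ Finset.univ.filter (fun p : Fin (k + 1) → Fin (m + 1) =>
      (α.toOrderHom ∘ p : Fin (k + 1) → Fin (n + 1)) = q),
      (if B.map (sortHom p).op (B.map α.op σ) = τ then ∏ i, t (p i) else 0) =
      if B.map (sortHom q).op σ = τ then ∏ i, t (p i) else 0 := by
    intro p hp
    obtain rfl := (Finset.mem_filter.1 hp).2
    rw [sortHom_comp, op_comp, Functor.map_comp]
    rfl
  rw [Finset.sum_congr rfl h1]
  split_ifs
  · simp only [stdSimplex.map_coe, FunOnFinite.linearMap_apply_apply]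
    rw [Finset.prod_univ_sum]
    refine Finset.sum_congr ?_ fun _ _ => rfl
    ext p
    simp [Fintype.mem_piFinset, funext_iff]
  · simp

lemma exists_weight (k : ℕ) (τ : B.obj (op (.mk k))) :
    ∃ f : SSet.toTop.obj B → ℝ, Continuous f ∧ ∀ (n : ℕ) (σ : B.obj (op (.mk n)))
      (t : SimplexCategory.toTop.{u}.obj (.mk n)), f (charMap B σ t) = weight τ σ t.down := by
  obtain ⟨f, hf⟩ := exists_toTop_desc (B := B) (X := TopCat.of (ULift.{u} ℝ))
    (fun n σ => TopCat.ofHom ⟨fun t => ULift.up (weight τ (n := n.len) σ t.down),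
      continuous_uliftUp.comp ((continuous_weight τ (n := n.len) σ).comp continuous_uliftDown)⟩) (by
      intro m n α σ
      ext t
      exact weight_map τ (m := m.len) (n := n.len) α σ t.down)
  refine ⟨fun x => (f x).down, continuous_uliftDown.comp f.hom.continuous, fun n σ t => ?_⟩
  exact congrArg ULift.down (congrArg
      (fun h : SimplexCategory.toTop.obj (.mk n) ⟶ TopCat.of (ULift.{u} ℝ) => h.hom t)
      (hf (.mk n) σ))

/-- The barycentric coordinates of a point of the topological simplex. -/
def coords {n : ℕ} (t : SimplexCategory.toTop.{u}.obj (.mk n)) : stdSimplex ℝ (Fin (n + 1)) :=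
  t.down

/-- Every point comes from the interior of a nondegenerate simplex. -/
lemma exists_nonDegenerate_charMap (x : SSet.toTop.obj B) :
    ∃ (n : ℕ) (σ : B.obj (op (.mk n))) (_ : σ ∈ B.nonDegenerate n)
      (t : SimplexCategory.toTop.{u}.obj (.mk n)), (∀ i, 0 < (coords t) i) ∧ charMap B σ t = x := by
  classical
  have hex : ∃ (n : ℕ) (σ : B.obj (op (.mk n))) (t : SimplexCategory.toTop.{u}.obj (.mk n)),
      charMap B σ t = x := by
    obtain ⟨n, σ, t, h⟩ := charMap_surjective B x
    exact ⟨n.len, σ, t, h⟩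
  obtain ⟨σ, t, h⟩ := Nat.find_spec hex
  have hmin := fun m => Nat.find_min (H := hex) (m := m)
  generalize Nat.find hex = n at *
  refine ⟨n, σ, ?_, t, ?_, h⟩
  · rintro ⟨m, hm, α, ρ, rfl⟩
    refine hmin m hm ⟨ρ, SimplexCategory.toTop.map α t, ?_⟩
    rw [charMap_map] at h
    exact h
  · intro i
    by_contra hi
    have hi : (coords t) i = 0 := le_antisymm (not_lt.1 hi) ((coords t).2.1 i)
    obtain _ | n := n
    · have h1 := stdSimplex.sum_eq_one (coords t)
      have h2 : ∀ j : Fin (0 + 1), (coords t) j = 0 := fun j => by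
        rw [Subsingleton.elim (α := Fin 1) j i]; exact hi
      rw [Finset.sum_eq_zero fun j _ => h2 j] at h1
      exact zero_ne_one h1
    · have i' : Fin (n + 2) := i
      have hs : ∑ j, (coords t) (Fin.succAbove (i : Fin (n + 2)) j) = 1 := by
        have h1 := stdSimplex.sum_eq_one (coords t)
        have h2 := Fin.sum_univ_succAbove (fun j => (coords t) j) (i : Fin (n + 2))
        rw [hi, zero_add] at h2
        exact h2.symm.trans h1
      let s : stdSimplex ℝ (Fin (n + 1)) :=
        ⟨fun j => (coords t) (Fin.succAbove (i : Fin (n + 2)) j), fun j => (coords t).2.1 _, hs⟩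
      refine hmin n (Nat.lt_succ_self n) ⟨B.map (SimplexCategory.δ (i : Fin (n + 2))).op σ,
        ULift.up s, ?_⟩
      rw [charMap_map, ← h]
      change charMap B σ (SimplexCategory.toTop.map (SimplexCategory.δ (i : Fin (n + 2)))
        (ULift.up s)) = _
      congr 1
      apply ULift.down_injective
      change stdSimplex.map (Fin.succAbove (i : Fin (n + 2))) s = (coords t)
      ext j
      rw [stdSimplex.map_coe, FunOnFinite.linearMap_apply_apply]
      rcases Fin.eq_self_or_eq_succAbove (i : Fin (n + 2)) j with rfl | ⟨l, rfl⟩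
      · rw [Finset.sum_eq_zero, hi]
        intro l hl
        exact absurd (Finset.mem_filter.1 hl).2 (Fin.succAbove_ne _ _)
      · have : (Finset.univ.filter fun a => Fin.succAbove (i : Fin (n + 2)) a =
            Fin.succAbove (i : Fin (n + 2)) l) = {l} := by
          ext a; simp
        rw [this, Finset.sum_singleton]
        rfl

/-- For a nondegenerate simplex and a surjection `g`, the weight function of the degenerate
simplex `g^* σ` is a positive multiple of a monomial in the barycentric coordinates. -/
lemma exists_weight_eq {n : ℕ} (σ : B.obj (op (.mk n))) (hσ : σ ∈ B.nonDegenerate n) {k : ℕ}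
    (g : SimplexCategory.mk k ⟶ SimplexCategory.mk n) [Epi g] :
    ∃ N : ℝ, 0 < N ∧ ∀ t : stdSimplex ℝ (Fin (n + 1)),
      weight (B.map g.op σ) σ t = N * ∏ i, t (g.toOrderHom i) := by
  classical
  refine ⟨((Finset.univ.filter fun p : Fin (k + 1) → Fin (n + 1) => sortHom p = g).card : ℝ),
    ?_, fun t => ?_⟩
  · rw [Nat.cast_pos, Finset.card_pos]
    exact ⟨g.toOrderHom, by simpa using sortHom_toOrderHom g⟩
  · unfold weight
    rw [← nsmul_eq_mul, ← Finset.sum_const, Finset.sum_filter]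
    refine Finset.sum_congr rfl fun p _ => ?_
    have h : B.map (sortHom p).op σ = B.map g.op σ ↔ sortHom p = g := by
      refine ⟨fun h => ?_, fun h => by rw [h]⟩
      exact (B.unique_nonDegenerate_map _ g ⟨σ, hσ⟩ rfl (sortHom p) ⟨σ, hσ⟩ h.symm).symm
    by_cases hp : sortHom p = g
    · rw [if_pos (h.2 hp), if_pos hp]
      have : ∀ i, t (g.toOrderHom i) = t (p (Tuple.sort p i)) := fun i => by
        rw [← hp]; rfl
      simp only [this]
      exact (Equiv.prod_comp (Tuple.sort p) fun i => t (p i)).symm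
    · rw [if_neg (mt h.1 hp), if_neg hp]

lemma exists_of_weight_pos {k : ℕ} (τ : B.obj (op (.mk k))) {n : ℕ} (σ : B.obj (op (.mk n)))
    (t : stdSimplex ℝ (Fin (n + 1))) (h : 0 < weight τ σ t) :
    ∃ g : SimplexCategory.mk k ⟶ SimplexCategory.mk n, B.map g.op σ = τ := by
  classical
  by_contra! hg
  unfold weight at h
  rw [Finset.sum_eq_zero fun p _ => if_neg (hg (sortHom p))] at h
  exact lt_irrefl _ h

instance (B : SSet.{u}) : T2Space (SSet.toTop.obj B) := by
  have key : ∀ x y : SSet.toTop.obj B,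
      (∀ f : SSet.toTop.obj B → ℝ, Continuous f → f x = f y) → x = y := by
    intro x y hxy
    obtain ⟨n, σ, hσ, t, ht, rfl⟩ := exists_nonDegenerate_charMap x
    obtain ⟨m, ρ, hρ, s, hs, rfl⟩ := exists_nonDegenerate_charMap y
    have hw : ∀ (k : ℕ) (τ : B.obj (op (.mk k))), weight τ σ (coords t) = weight τ ρ (coords s) := by
      intro k τ
      obtain ⟨f, hf, hf'⟩ := exists_weight k τ
      exact (hf' n σ t).symm.trans ((hxy f hf).trans (hf' m ρ s))
    have hpos : ∀ {n : ℕ} (σ : B.obj (op (.mk n))) (_ : σ ∈ B.nonDegenerate n)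
        (t : SimplexCategory.toTop.{u}.obj (.mk n)) (_ : ∀ i, 0 < (coords t) i),
        0 < weight σ σ (coords t) := by
      intro n σ hσ t ht
      obtain ⟨N, hN, h⟩ := exists_weight_eq σ hσ (𝟙 _)
      have h := h (coords t)
      have hid : B.map (𝟙 (SimplexCategory.mk n)).op σ = σ := by simp
      rw [hid] at h
      exact h ▸ mul_pos hN (Finset.prod_pos fun i _ => ht i)
    obtain ⟨g, hg⟩ := exists_of_weight_pos σ ρ (coords s) (hw n σ ▸ hpos σ hσ t ht)
    obtain ⟨g', hg'⟩ := exists_of_weight_pos ρ σ (coords t) ((hw m ρ).symm ▸ hpos ρ hρ s hs)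
    have hm := B.mono_of_nonDegenerate ⟨σ, hσ⟩ g ρ hg
    have hm' := B.mono_of_nonDegenerate ⟨ρ, hρ⟩ g' σ hg'
    obtain rfl : n = m := le_antisymm (SimplexCategory.len_le_of_mono g)
      (SimplexCategory.len_le_of_mono g')
    obtain rfl := SimplexCategory.eq_id_of_mono g
    obtain rfl : ρ = σ := by simpa using hg
    congr 1
    apply ULift.down_injective
    change coords t = coords s
    ext j
    obtain ⟨N, hN, h⟩ := exists_weight_eq ρ hρ (𝟙 _)
    obtain ⟨M, hM, h'⟩ := exists_weight_eq ρ hρ (SimplexCategory.σ j)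
    have h1 : ∏ i, (coords t) i = ∏ i, (coords s) i := by
      have := (h (coords t)).symm.trans ((hw _ _).trans (h (coords s)))
      exact mul_left_cancel₀ hN.ne' this
    have h2 : ∀ t : stdSimplex ℝ (Fin (n + 1)),
        ∏ i, t ((SimplexCategory.σ j).toOrderHom i) = t j * ∏ i, t i := by
      intro t
      have := Fin.prod_univ_succAbove (fun i : Fin (n + 2) => t (j.predAbove i)) j.castSucc
      have h0 : ∏ i : Fin (n + 2), t (j.predAbove i) = t j * ∏ i, t i := by simpa using this
      exact h0
    have h3 := (h' (coords t)).symm.trans ((hw _ _).trans (h' (coords s)))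
    have h3 := mul_left_cancel₀ hM.ne' h3
    rw [h2, h2, h1] at h3
    exact mul_right_cancel₀ (Finset.prod_pos fun i _ => hs i).ne' h3
  refine ⟨fun x y hxy => ?_⟩
  obtain ⟨f, hf, hne⟩ : ∃ f : SSet.toTop.obj B → ℝ, Continuous f ∧ f x ≠ f y := by
    by_contra! h
    exact hxy (key x y h)
  exact separated_by_continuous hf hne

end Separation

/-- The circulation of the stream realization: `x ≤_U y` when `x` and `y` are joined by a chain of
relations in `U`, each coming from a simplex `|Δ[n]| → |B|`. This is the colimit circulation. -/
noncomputable def realizationCirculation (B : SSet.{u}) : Circulation (SSet.toTop.obj B) :=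
  Circulation.final (ι := Σ n : SimplexCategory, B.obj (op n))
    (fun i => simplexCirculation i.1) (fun i => (charMap B i.2).hom)

lemma realizationCirculation_isKCirculation (B : SSet.{u}) :
    (realizationCirculation B).IsKCirculation :=
  Circulation.isKCirculation_final _ _ fun i => simplexCirculation_isKCirculation i.1

/-- The universal property of the realization: a continuous map out of `|B|` is a stream map if and
only if its composite with every simplex `|Δ[n]| → |B|` is a stream map. -/
lemma isStreamMap_realization_iff (B : SSet.{u}) {Z : Type v} [TopologicalSpace Z]
    (d : Circulation Z) (g : C(SSet.toTop.obj B, Z)) :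
    Circulation.IsStreamMap (realizationCirculation B) d g ↔
      ∀ (n : SimplexCategory) (σ : B.obj (op n)),
        Circulation.IsStreamMap (simplexCirculation n) d (g.comp (charMap B σ).hom) :=
  ⟨fun h n σ => h.comp (Circulation.IsStreamMap.comp_final
    (ι := Σ n : SimplexCategory, B.obj (op n)) (fun i => simplexCirculation i.1)
    (fun i => (charMap B i.2).hom) ⟨n, σ⟩),
  fun h => Circulation.IsStreamMap.of_final _ _ _ _ fun i => h i.1 i.2⟩

/-- The realization of the standard simplex is the topological simplex with its own circulation. -/
lemma isStreamMap_toTopSimplex (n : SimplexCategory) :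
    Circulation.IsStreamMap (simplexCirculation.{u} n)
        (realizationCirculation (SSet.stdSimplex.{u}.obj n)) (SSet.toTopSimplex.inv.app n).hom ∧
      Circulation.IsStreamMap (realizationCirculation (SSet.stdSimplex.{u}.obj n))
        (simplexCirculation.{u} n) (SSet.toTopSimplex.hom.app n).hom := by
  constructor
  · have h := Circulation.IsStreamMap.comp_final
      (ι := Σ m : SimplexCategory, (SSet.stdSimplex.{u}.obj n).obj (op m))
      (fun i => simplexCirculation i.1) (fun i => (charMap _ i.2).hom)
      ⟨n, SSet.stdSimplex.objEquiv.symm (𝟙 n)⟩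
    have h' : charMap (SSet.stdSimplex.{u}.obj n)
        (SSet.stdSimplex.objEquiv.symm (β := n ⟶ n) (𝟙 n)) = SSet.toTopSimplex.inv.app n := by
      rw [charMap, SSet.yonedaEquiv_symm_stdSimplex_id, SSet.toTop.map_id]
      exact Category.comp_id _
    rw [← h']
    exact h
  · rw [isStreamMap_realization_iff]
    intro m σ
    obtain ⟨α, rfl⟩ := SSet.stdSimplex.objEquiv.symm.surjective σ
    have h : charMap (SSet.stdSimplex.{u}.obj n) (SSet.stdSimplex.objEquiv.symm α) ≫
        SSet.toTopSimplex.hom.app n = SimplexCategory.toTop.map α := by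
      have h1 : SSet.yonedaEquiv.symm (SSet.stdSimplex.objEquiv.symm α) =
        SSet.stdSimplex.{u}.map α := rfl
      rw [charMap, h1, Category.assoc]
      have h2 := SSet.toTopSimplex.{u}.hom.naturality α
      have h3 := congrArg (fun f => SSet.toTopSimplex.{u}.inv.app m ≫ f) h2
      refine h3.trans ?_
      have h4 := SSet.toTopSimplex.{u}.inv_hom_id_app m
      exact (Category.assoc _ _ _).symm.trans ((congrArg (fun f => f ≫
        SimplexCategory.toTop.{u}.map α) h4).trans (Category.id_comp _))
    have h' := congrArg TopCat.Hom.hom h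
    rw [TopCat.hom_comp] at h'
    rw [h']
    exact isStreamMap_simplex_map α

lemma isStreamMap_toTop_map {B C : SSet.{u}} (f : B ⟶ C) :
    Circulation.IsStreamMap (realizationCirculation B) (realizationCirculation C)
      (SSet.toTop.map f).hom := by
  refine Circulation.IsStreamMap.of_final _ _ _ _ fun i => ?_
  have h : (SSet.toTop.map f).hom.comp (charMap B i.2).hom = (charMap C (f.app _ i.2)).hom := by
    rw [← charMap_comp_map]; rfl
  rw [h]
  exact Circulation.IsStreamMap.comp_final
    (ι := Σ n : SimplexCategory, C.obj (op n)) (fun i => simplexCirculation i.1)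
    (fun i => (charMap C i.2).hom) ⟨i.1, f.app _ i.2⟩

end Realization

/-- The stream realization of simplicial sets: the geometric realization equipped with the
circulation which is final with respect to all simplices. -/
noncomputable def streamRealization : SSet.{u} ⥤ StreamCat.{u} where
  obj B :=
    { carrier := SSet.toTop.obj B
      circulation := Realization.realizationCirculation B
      isKCirculation := Realization.realizationCirculation_isKCirculation B }
  map f := ⟨(SSet.toTop.map f).hom, Realization.isStreamMap_toTop_map f⟩
  map_id B := StreamCat.Hom.ext (congrArg TopCat.Hom.hom (SSet.toTop.map_id B))
  map_comp f g := StreamCat.Hom.ext (congrArg TopCat.Hom.hom (SSet.toTop.map_comp f g))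

/-! Finite products reduce to the empty one and the binary ones. The empty one is easy, since the
point realizes to a single point. The binary case asks that stream maps `f : X → |B|` and `g : X →
|C|` combine to a unique stream map `X → |B × C|`.

On points, this rests on the triangulation of the prism `|Δ[m]| × |Δ[n]|`. Describing `t` and `s` by
their partial sums and merging these on one line yields a chain in `[m] × [n]` carrying masses with
marginals `t` and `s` (`exists_refinement_pair`). Moreover, monotone maps with the same effect on a
point agree on its support (`exists_equalizer`). Together these make `|B × C| → |B| × |C|` bijective
(`toTop_prod_ext`, `exists_toTop_prod`). For continuity, a compact set lies in finitely many
simplices, so the pairing of two maps on a compact space takes values in a compact part of `|B ×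
C|`; as `X` is a k-space, compact probes suffice (`continuous_pair`).

For the circulations, the cells of a prism are separated by the finitely many walls `headSum t i =
headSum s j`. An increasing segment in `|Δ[m]| × {s}` can be cut at these walls, and each piece is
an increasing segment of one simplex of the product. Hence the slices `|B| × {y}` and `{x} × |C|`
include by stream maps (`isStreamMap_slice`, `isStreamMap_slice'`). A relation in `X` is witnessed
on a compact Hausdorff `K`. Since `K` is locally compact, it is covered by small open sets on which
`f` and `g` stay in a box inside the given open set; there each relation is a move in `|B|` followed
by a move in `|C|`, both along slices (`isStreamMap_pair`). -/

/-! ### Couplings of mass distributions and the triangulation of a prism. -/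

section Refinement

/-- The sum of the first entries of `x`, up to the index `j`. -/
def headSum {n : ℕ} (x : Fin (n + 1) → ℝ) (j : Fin (n + 1)) : ℝ :=
  ∑ i, if i ≤ j then x i else 0

lemma headSum_zero {n : ℕ} (x : Fin (n + 1) → ℝ) : headSum x 0 = x 0 := by
  simp [headSum]

lemma headSum_succ {n : ℕ} (x : Fin (n + 2) → ℝ) (j : Fin (n + 1)) :
    headSum x j.succ = x 0 + headSum (fun i => x i.succ) j := by
  simp [headSum, Fin.sum_univ_succ]

lemma headSum_sub_head {n : ℕ} (x : Fin (n + 1) → ℝ) (a : ℝ) (j : Fin (n + 1)) :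
    headSum (Function.update x 0 (x 0 - a)) j = headSum x j - a := by
  cases n with
  | zero =>
    obtain rfl : j = 0 := Subsingleton.elim (α := Fin 1) _ _
    simp [headSum_zero]
  | succ n =>
    refine Fin.cases ?_ (fun j => ?_) j
    · simp [headSum_zero]
    · rw [headSum_succ, headSum_succ]
      simp only [Function.update_self, Function.update_of_ne (Fin.succ_ne_zero _)]
      ring

lemma headSum_last {n : ℕ} (x : Fin (n + 1) → ℝ) : headSum x (Fin.last n) = ∑ i, x i := by
  simp [headSum, Fin.le_last]

/-- Two pairs of mass distributions `(t, s)` and `(t', s')` have simultaneous comonotone couplings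
`w`, `w'` along one chain `(p, q)`, with comparable partial sums. -/
def HasRefinement {m n : ℕ} (t t' : Fin (m + 1) → ℝ) (s s' : Fin (n + 1) → ℝ) (c c' : ℝ) : Prop :=
  ∃ k ≤ m + n, ∃ (p : Fin (k + 1) →o Fin (m + 1)) (q : Fin (k + 1) →o Fin (n + 1))
    (w w' : Fin (k + 1) → ℝ), (∀ i, 0 ≤ w i) ∧ (∀ i, 0 ≤ w' i) ∧
    (∀ i, ∑ l, (if p l = i then w l else 0) = t i) ∧
    (∀ i, ∑ l, (if p l = i then w' l else 0) = t' i) ∧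
    (∀ i, ∑ l, (if q l = i then w l else 0) = s i) ∧
    (∀ i, ∑ l, (if q l = i then w' l else 0) = s' i) ∧
    ∀ l, c' + headSum w' l ≤ c + headSum w l

lemma HasRefinement.symm {m n : ℕ} {t t' : Fin (m + 1) → ℝ} {s s' : Fin (n + 1) → ℝ} {c c' : ℝ}
    (h : HasRefinement t t' s s' c c') : HasRefinement s s' t t' c c' := by
  obtain ⟨k, hk, p, q, w, w', h1, h2, h3, h4, h5, h6, h7⟩ := h
  exact ⟨k, by omega, q, p, w, w', h1, h2, h5, h6, h3, h4, h7⟩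

/-- A prism over a point is a simplex: the chain runs through the vertices of the other factor, and
`s`, `s'` themselves are the couplings. This is the base of the induction. -/
lemma hasRefinement_of_eq_zero {n : ℕ} {t t' : Fin 1 → ℝ} {s s' : Fin (n + 1) → ℝ} {c c' : ℝ}
    (hs : ∀ i, 0 ≤ s i) (hs' : ∀ i, 0 ≤ s' i) (h : ∑ i, t i = ∑ i, s i)
    (h' : ∑ i, t' i = ∑ i, s' i) (hc : ∀ i, c' + headSum s' i ≤ c + headSum s i) :
    HasRefinement t t' s s' c c' := by
  refine ⟨n, by omega, ⟨fun _ => 0, fun _ _ _ => le_rfl⟩, OrderHom.id, s, s', hs, hs', ?_, ?_,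
    ?_, ?_, hc⟩
  · intro i
    obtain rfl : i = 0 := Subsingleton.elim (α := Fin 1) _ _
    exact (Finset.sum_congr rfl fun _ _ => if_pos rfl).trans (h.symm.trans (by simp))
  · intro i
    obtain rfl : i = 0 := Subsingleton.elim (α := Fin 1) _ _
    exact (Finset.sum_congr rfl fun _ _ => if_pos rfl).trans (h'.symm.trans (by simp))
  · intro i; simp
  · intro i; simp

/-- Prepend a common first vertex that carries the whole first mass of `t`. -/
lemma HasRefinement.cons {m n : ℕ} {t t' : Fin (m + 2) → ℝ} {s s' : Fin (n + 1) → ℝ} {c c' : ℝ}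
    (ht : 0 ≤ t 0) (ht' : 0 ≤ t' 0) (hc : c' + t' 0 ≤ c + t 0)
    (h : HasRefinement (fun i => t i.succ) (fun i => t' i.succ)
      (Function.update s 0 (s 0 - t 0)) (Function.update s' 0 (s' 0 - t' 0))
      (c + t 0) (c' + t' 0)) : HasRefinement t t' s s' c c' := by
  obtain ⟨k, hk, p, q, w, w', h1, h2, h3, h4, h5, h6, h7⟩ := h
  have key : ∀ (t : Fin (m + 2) → ℝ) (w : Fin (k + 1) → ℝ)
      (_ : ∀ i, ∑ l, (if p l = i then w l else 0) = t i.succ) (i : Fin (m + 2)),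
      ∑ l : Fin (k + 2), (if (Fin.cases 0 (fun l => (p l).succ) l : Fin (m + 2)) = i
        then (Fin.cases (t 0) w l : ℝ) else 0) = t i := by
    intro t w h i
    rw [Fin.sum_univ_succ]
    refine Fin.cases ?_ (fun i => ?_) i
    · simp [Fin.succ_ne_zero]
    · simp only [Fin.cases_zero, Fin.cases_succ, Fin.succ_inj, h]
      simp [(Fin.succ_ne_zero _).symm]
  have key' : ∀ (s : Fin (n + 1) → ℝ) (a : ℝ) (w : Fin (k + 1) → ℝ)
      (_ : ∀ i, ∑ l, (if q l = i then w l else 0) = Function.update s 0 (s 0 - a) i)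
      (i : Fin (n + 1)),
      ∑ l : Fin (k + 2), (if (Fin.cases 0 (fun l => q l) l : Fin (n + 1)) = i
        then (Fin.cases a w l : ℝ) else 0) = s i := by
    intro s a w h i
    rw [Fin.sum_univ_succ]
    refine (congrArg (_ + ·) (h i)).trans ?_
    by_cases hi : i = 0
    · subst hi; simp
    · simp [hi, Ne.symm hi]
  -- After the new vertex `(0, 0)` the first coordinate moves on, hence `succ`; the second may stay
  -- at `0`, where the mass `s 0 - t 0` is still to be spent.
  refine ⟨k + 1, by omega, ⟨Fin.cases 0 fun l => (p l).succ, ?_⟩, ⟨Fin.cases 0 fun l => q l, ?_⟩,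
    Fin.cases (t 0) w, Fin.cases (t' 0) w', ?_, ?_, key t w h3, key t' w' h4,
    key' s _ w h5, key' s' _ w' h6, ?_⟩
  · intro a b
    refine Fin.cases (fun _ => Fin.zero_le _) (fun a => ?_) a
    refine Fin.cases (fun h => absurd h (by simp)) (fun b h => ?_) b
    simpa using p.monotone (Fin.succ_le_succ_iff.1 h)
  · intro a b
    refine Fin.cases (fun _ => Fin.zero_le _) (fun a => ?_) a
    refine Fin.cases (fun h => absurd h (by simp)) (fun b h => ?_) b
    simpa using q.monotone (Fin.succ_le_succ_iff.1 h)
  · exact Fin.cases ht h1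
  · exact Fin.cases ht' h2
  · refine Fin.cases ?_ fun l => ?_
    · simpa [headSum_zero] using hc
    · rw [headSum_succ, headSum_succ]
      simpa [add_assoc] using h7 l

/-- Merge the breakpoints of the two distributions greedily: the smaller first mass becomes the mass
of the vertex `(0, 0)` and is removed from both sides. The last hypothesis, that both points are on
the same side of every wall, makes the same choice correct for the primed and unprimed data. The
offsets `c`, `c'` record the mass already spent, which differs between the two points, so that the
comparison of partial sums survives the removal. -/
lemma hasRefinement_aux (N : ℕ) : ∀ {m n : ℕ} (_ : m + n = N) (t t' : Fin (m + 1) → ℝ)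
    (s s' : Fin (n + 1) → ℝ) (c c' : ℝ), (∀ i, 0 ≤ t i) → (∀ i, 0 ≤ t' i) → (∀ i, 0 ≤ s i) →
    (∀ i, 0 ≤ s' i) → ∑ i, t i = ∑ i, s i → ∑ i, t' i = ∑ i, s' i →
    (∀ i, c' + headSum t' i ≤ c + headSum t i) → (∀ i, c' + headSum s' i ≤ c + headSum s i) →
    (∀ i j, (headSum t i ≤ headSum s j ∧ headSum t' i ≤ headSum s' j) ∨
      (headSum s j ≤ headSum t i ∧ headSum s' j ≤ headSum t' i)) →
    HasRefinement t t' s s' c c' := by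
  induction N with
  | zero =>
    intro m n hmn t t' s s' c c' ht ht' hs hs' h h' h1 h2 _
    obtain rfl : m = 0 := by omega
    exact hasRefinement_of_eq_zero hs hs' h h' h2
  | succ N ih =>
    have step : ∀ {m n : ℕ} (_ : m + n = N) (t t' : Fin (m + 2) → ℝ)
        (s s' : Fin (n + 1) → ℝ) (c c' : ℝ), (∀ i, 0 ≤ t i) → (∀ i, 0 ≤ t' i) → (∀ i, 0 ≤ s i) →
        (∀ i, 0 ≤ s' i) → ∑ i, t i = ∑ i, s i → ∑ i, t' i = ∑ i, s' i →
        (∀ i, c' + headSum t' i ≤ c + headSum t i) → (∀ i, c' + headSum s' i ≤ c + headSum s i) →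
        (∀ i j, (headSum t i ≤ headSum s j ∧ headSum t' i ≤ headSum s' j) ∨
          (headSum s j ≤ headSum t i ∧ headSum s' j ≤ headSum t' i)) →
        t 0 ≤ s 0 → t' 0 ≤ s' 0 → HasRefinement t t' s s' c c' := by
      intro m n hmn t t' s s' c c' ht ht' hs hs' h h' h1 h2 h3 h0 h0'
      have hc := h1 0
      rw [headSum_zero, headSum_zero] at hc
      refine .cons (ht 0) (ht' 0) hc (ih hmn _ _ _ _ _ _ (fun i => ht _) (fun i => ht' _)
        ?_ ?_ ?_ ?_ ?_ ?_ ?_)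
      · intro i
        by_cases hi : i = 0
        · subst hi; simpa using h0
        · simpa [hi] using hs i
      · intro i
        by_cases hi : i = 0
        · subst hi; simpa using h0'
        · simpa [hi] using hs' i
      · rw [← headSum_last (Function.update _ _ _), headSum_sub_head, headSum_last, ← h,
          Fin.sum_univ_succ t]
        ring
      · rw [← headSum_last (Function.update _ _ _), headSum_sub_head, headSum_last, ← h',
          Fin.sum_univ_succ t']
        ring
      · intro i
        have := h1 i.succ
        rw [headSum_succ, headSum_succ] at this
        linarith
      · intro i
        have := h2 i
        rw [headSum_sub_head, headSum_sub_head]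
        linarith
      · intro i j
        have := h3 i.succ j
        rw [headSum_succ, headSum_succ] at this
        rw [headSum_sub_head, headSum_sub_head]
        refine this.imp (fun h => ⟨?_, ?_⟩) fun h => ⟨?_, ?_⟩ <;> linarith [h.1, h.2]
    intro m n hmn t t' s s' c c' ht ht' hs hs' h h' h1 h2 h3
    obtain _ | m := m
    · exact hasRefinement_of_eq_zero hs hs' h h' h2
    obtain _ | n := n
    · exact (hasRefinement_of_eq_zero ht ht' h.symm h'.symm h1).symm
    -- The wall `(0, 0)` decides which factor loses its first vertex; exchanging the factors reduces
    -- one case to the other.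
    have h0 := h3 0 0
    simp only [headSum_zero] at h0
    rcases h0 with h0 | h0
    · exact step (by omega) t t' s s' c c' ht ht' hs hs' h h' h1 h2 h3 h0.1 h0.2
    · exact (step (by omega) s s' t t' c c' hs hs' ht ht' h.symm h'.symm h2 h1
        (fun i j => (h3 j i).symm) h0.1 h0.2).symm

lemma simplexTail_succ {n : ℕ} (x : stdSimplex ℝ (Fin (n + 1))) (j : Fin (n + 1))
    (i : Fin (n + 1)) (hij : (i : ℕ) = j + 1) : simplexTail x i = 1 - headSum x j := by
  rw [← stdSimplex.sum_eq_one x, simplexTail, headSum, ← Finset.sum_filter, eq_sub_iff_add_eq,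
    ← Finset.sum_filter_add_sum_filter_not Finset.univ (fun l => l ≤ j), add_comm]
  congr 1
  refine Finset.sum_congr ?_ fun _ _ => rfl
  ext l
  simp only [Finset.mem_Ici, Finset.mem_filter, Finset.mem_univ, true_and, Fin.le_def, hij]
  omega

lemma simplexTail_zero {n : ℕ} (x : stdSimplex ℝ (Fin (n + 1))) : simplexTail x 0 = 1 := by
  rw [← stdSimplex.sum_eq_one x, simplexTail]
  congr 1
  ext; simp

/-- Tails and heads are complementary in total mass `1`, which reverses the inequality. The cases `j
= 0` for tails and `j = Fin.last n` for heads have no complementary index, but there both sums equal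
`1`. -/
lemma simplexLE_iff_headSum {n : ℕ} (x y : stdSimplex ℝ (Fin (n + 1))) :
    simplexLE x y ↔ ∀ j, headSum y j ≤ headSum x j := by
  constructor
  · intro h j
    by_cases hj : j = Fin.last n
    · subst hj
      rw [headSum_last, headSum_last, stdSimplex.sum_eq_one, stdSimplex.sum_eq_one]
    · have hlt : (j : ℕ) + 1 < n + 1 := by
        have := Fin.val_lt_last hj
        omega
      have := h ⟨j + 1, hlt⟩
      rw [simplexTail_succ x j _ rfl, simplexTail_succ y j _ rfl] at this
      linarith
  · intro h j
    by_cases hj : j = 0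
    · subst hj
      rw [simplexTail_zero, simplexTail_zero]
    · have h0 : 0 < (j : ℕ) := Nat.pos_of_ne_zero fun h => hj (Fin.ext h)
      have := h ⟨j - 1, by omega⟩
      rw [simplexTail_succ x ⟨j - 1, by omega⟩ j (by simp; omega),
        simplexTail_succ y ⟨j - 1, by omega⟩ j (by simp; omega)]
      linarith

lemma stdSimplex_map_apply {k n : ℕ} (a : Fin (k + 1) → Fin (n + 1))
    (x : stdSimplex ℝ (Fin (k + 1))) (i : Fin (n + 1)) :
    stdSimplex.map a x i = ∑ l, if a l = i then x l else 0 := by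
  classical
  rw [stdSimplex.map_coe, FunOnFinite.linearMap_apply_apply, Finset.sum_filter]

/-- Two comparable points `(t, s) ≤ (t', s')` of a product of simplices, in the same cell of the
standard triangulation, lie in a common simplex of the triangulation and are comparable there. -/
lemma exists_refinement_pair {m n : ℕ} (t t' : stdSimplex ℝ (Fin (m + 1)))
    (s s' : stdSimplex ℝ (Fin (n + 1))) (ht : simplexLE t t') (hs : simplexLE s s')
    (h : ∀ i j, (headSum t i ≤ headSum s j ∧ headSum t' i ≤ headSum s' j) ∨
      (headSum s j ≤ headSum t i ∧ headSum s' j ≤ headSum t' i)) :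
    ∃ k ≤ m + n, ∃ (p : Fin (k + 1) →o Fin (m + 1)) (q : Fin (k + 1) →o Fin (n + 1))
      (w w' : stdSimplex ℝ (Fin (k + 1))), stdSimplex.map p w = t ∧ stdSimplex.map p w' = t' ∧
      stdSimplex.map q w = s ∧ stdSimplex.map q w' = s' ∧ simplexLE w w' := by
  have hsum {k : ℕ} (x : stdSimplex ℝ (Fin (k + 1))) := stdSimplex.sum_eq_one x
  obtain ⟨k, hk, p, q, w, w', h1, h2, h3, h4, h5, h6, h7⟩ :=
    hasRefinement_aux _ rfl t t' s s' 0 0 t.2.1 t'.2.1 s.2.1 s'.2.1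
      ((hsum t).trans (hsum s).symm) ((hsum t').trans (hsum s').symm)
      (by simpa using (simplexLE_iff_headSum _ _).1 ht)
      (by simpa using (simplexLE_iff_headSum _ _).1 hs) h
  have total : ∀ (t : stdSimplex ℝ (Fin (m + 1))) (w : Fin (k + 1) → ℝ)
      (_ : ∀ i, ∑ l, (if p l = i then w l else 0) = t i), ∑ l, w l = 1 := by
    intro t w hw
    rw [← hsum t, ← Finset.sum_congr rfl fun i _ => hw i, Finset.sum_comm]
    simp
  refine ⟨k, hk, p, q, ⟨w, h1, total t w h3⟩, ⟨w', h2, total t' w' h4⟩, ?_, ?_, ?_, ?_, ?_⟩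
  · ext i; exact (stdSimplex_map_apply _ _ _).trans (h3 i)
  · ext i; exact (stdSimplex_map_apply _ _ _).trans (h4 i)
  · ext i; exact (stdSimplex_map_apply _ _ _).trans (h5 i)
  · ext i; exact (stdSimplex_map_apply _ _ _).trans (h6 i)
  · rw [simplexLE_iff_headSum]
    intro j
    have := h7 j
    rwa [zero_add, zero_add] at this

/-- For a single point the cell condition is just totality of the order on `ℝ`. -/
lemma exists_refinement {m n : ℕ} (t : stdSimplex ℝ (Fin (m + 1)))
    (s : stdSimplex ℝ (Fin (n + 1))) :
    ∃ k ≤ m + n, ∃ (p : Fin (k + 1) →o Fin (m + 1)) (q : Fin (k + 1) →o Fin (n + 1))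
      (w : stdSimplex ℝ (Fin (k + 1))), stdSimplex.map p w = t ∧ stdSimplex.map q w = s := by
  obtain ⟨k, hk, p, q, w, -, h1, -, h2, -⟩ := exists_refinement_pair t t s s (fun _ => le_rfl)
    (fun _ => le_rfl) fun i j => (le_total _ _).imp (fun h => ⟨h, h⟩) fun h => ⟨h, h⟩
  exact ⟨k, hk, p, q, w, h1, h2⟩

/-- Two monotone maps with the same effect on `t` agree on the support of `t`. -/
lemma exists_equalizer {m n : ℕ} (a b : Fin (m + 1) →o Fin (n + 1))
    (t : stdSimplex ℝ (Fin (m + 1))) (h : stdSimplex.map a t = stdSimplex.map b t) :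
    ∃ (k : ℕ) (e : Fin (k + 1) →o Fin (m + 1)) (w : stdSimplex ℝ (Fin (k + 1))),
      stdSimplex.map e w = t ∧ a.comp e = b.comp e := by
  classical
  -- If `a i < b i`, the vertices that `a` sends to `b i` or above form a subset of those that `b`
  -- sends there, and this subset misses `i`. As `i` has positive mass, the tails at `b i` differ.
  have key : ∀ (a b : Fin (m + 1) →o Fin (n + 1)) (_ : stdSimplex.map a t = stdSimplex.map b t)
      (i : Fin (m + 1)), 0 < t i → b i ≤ a i := by
    intro a b h i hi
    by_contra! hlt
    have h1 := simplexTail_map a t (b i)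
    rw [h, simplexTail_map] at h1
    have hsub : (Finset.univ.filter fun l => b i ≤ a l) ⊂ Finset.univ.filter fun l => b i ≤ b l := by
      refine Finset.ssubset_iff_of_subset (fun l hl => ?_) |>.2 ⟨i, by simp, by simpa using hlt⟩
      simp only [Finset.mem_filter, Finset.mem_univ, true_and] at hl ⊢
      refine b.monotone (le_of_not_gt fun hli => ?_)
      exact absurd (hl.trans (a.monotone hli.le)) (not_le.2 hlt)
    refine absurd h1 (ne_of_gt ?_)
    refine Finset.sum_lt_sum_of_subset hsub.1 (i := i) (by simp) (by simpa using hlt) hi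
      fun l _ _ => t.2.1 l
  have hab : ∀ i, 0 < t i → a i = b i := fun i hi =>
    le_antisymm (key b a h.symm i hi) (key a b h i hi)
  set S := Finset.univ.filter fun i => 0 < t i with hS
  have hne : S.Nonempty := by
    by_contra hS'
    rw [Finset.not_nonempty_iff_eq_empty] at hS'
    have h0 : ∀ i, t i = 0 := fun i => by
      have : i ∉ S := by simp [hS']
      simp only [hS, Finset.mem_filter, Finset.mem_univ, true_and, not_lt] at this
      exact le_antisymm this (t.2.1 i)
    have := stdSimplex.sum_eq_one t
    simp [h0] at this
  -- A simplex on the support has dimension `S.card - 1`, which requires the support to be nonempty.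
  have hcard : S.card = S.card - 1 + 1 := (Nat.sub_add_cancel hne.card_pos).symm
  let e := S.orderEmbOfFin hcard
  have hsum : ∀ f : Fin (m + 1) → ℝ, (∀ i, ¬ 0 < t i → f i = 0) →
      ∑ l, f (e l) = ∑ i, f i := by
    intro f hf
    have h1 : ∑ l, f (e l) = ∑ i ∈ S, f i := by
      have := Finset.sum_map Finset.univ e.toEmbedding f
      rw [Finset.map_orderEmbOfFin_univ S hcard] at this
      exact this.symm
    rw [h1]
    refine Finset.sum_subset (Finset.subset_univ _) fun i _ hi => hf i ?_
    simpa [hS] using hi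
  have ht0 : ∀ i, ¬ 0 < t i → t i = 0 := fun i hi => le_antisymm (not_lt.1 hi) (t.2.1 i)
  refine ⟨S.card - 1, ⟨e, e.monotone⟩, ⟨fun l => t (e l), fun l => t.2.1 _, ?_⟩, ?_, ?_⟩
  · rw [hsum (fun i => t i) ht0]
    exact stdSimplex.sum_eq_one t
  · ext i
    rw [stdSimplex_map_apply]
    have := hsum (fun l => if l = i then t l else 0) fun l hl => by simp [ht0 l hl]
    refine Eq.trans ?_ (this.trans (by simp))
    rfl
  · ext l : 2
    refine hab _ ?_
    exact (Finset.mem_filter.1 (S.orderEmbOfFin_mem hcard l)).2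

end Refinement

/-! ### When two simplices represent the same point. -/

namespace Realization

open MonoidalCategory CartesianMonoidalCategory

lemma toTop_map_comp_apply {l m n : SimplexCategory} (a : l ⟶ m) (b : m ⟶ n)
    (t : SimplexCategory.toTop.{u}.obj l) :
    SimplexCategory.toTop.map (a ≫ b) t =
      SimplexCategory.toTop.map b (SimplexCategory.toTop.map a t) := by
  rw [Functor.map_comp]; rfl

lemma toTop_map_id_apply {n : SimplexCategory} (t : SimplexCategory.toTop.{u}.obj n) :
    SimplexCategory.toTop.map (𝟙 n) t = t := by
  rw [CategoryTheory.Functor.map_id]; rfl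

lemma exists_common_simplex {m n : SimplexCategory} (t : SimplexCategory.toTop.{u}.obj m)
    (s : SimplexCategory.toTop.{u}.obj n) :
    ∃ k ≤ m.len + n.len, ∃ (p : .mk k ⟶ m) (q : .mk k ⟶ n)
      (w : SimplexCategory.toTop.{u}.obj (.mk k)),
      SimplexCategory.toTop.map p w = t ∧ SimplexCategory.toTop.map q w = s := by
  obtain ⟨k, hk, p, q, w, hp, hq⟩ := exists_refinement (m := m.len) (n := n.len) t.down s.down
  exact ⟨k, hk, SimplexCategory.Hom.mk p, SimplexCategory.Hom.mk q, ULift.up w,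
    ULift.down_injective hp, ULift.down_injective hq⟩

lemma exists_equalizing {m n : SimplexCategory} (a b : m ⟶ n)
    (t : SimplexCategory.toTop.{u}.obj m)
    (h : SimplexCategory.toTop.map a t = SimplexCategory.toTop.map b t) :
    ∃ (k : SimplexCategory) (e : k ⟶ m) (w : SimplexCategory.toTop.{u}.obj k),
      SimplexCategory.toTop.map e w = t ∧ e ≫ a = e ≫ b := by
  obtain ⟨k, e, w, hw, he⟩ := exists_equalizer (m := m.len) (n := n.len) a.toOrderHom b.toOrderHom
    t.down (congrArg ULift.down h)
  exact ⟨.mk k, SimplexCategory.Hom.mk e, ULift.up w, ULift.down_injective hw,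
    SimplexCategory.Hom.ext _ _ he⟩

/-- Two simplices over the same point of a simplex have a common refinement. -/
lemma exists_amalgamation {m m' n : SimplexCategory} (a : m ⟶ n) (b : m' ⟶ n)
    (t : SimplexCategory.toTop.{u}.obj m) (s : SimplexCategory.toTop.{u}.obj m')
    (h : SimplexCategory.toTop.map a t = SimplexCategory.toTop.map b s) :
    ∃ (k : SimplexCategory) (p : k ⟶ m) (q : k ⟶ m') (w : SimplexCategory.toTop.{u}.obj k),
      SimplexCategory.toTop.map p w = t ∧ SimplexCategory.toTop.map q w = s ∧ p ≫ a = q ≫ b := by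
  obtain ⟨k, -, p, q, w, rfl, rfl⟩ := exists_common_simplex t s
  obtain ⟨l, e, v, rfl, he⟩ := exists_equalizing (p ≫ a) (q ≫ b) w (by
    rw [toTop_map_comp_apply, toTop_map_comp_apply, h])
  exact ⟨l, e ≫ p, e ≫ q, v, toTop_map_comp_apply _ _ _, toTop_map_comp_apply _ _ _,
    by simpa using he⟩

/-- Pairs of a simplex of `B` and a point in it, representing the same point of `|B|`. -/
def pointSetoid (B : SSet.{u}) :
    Setoid (Σ n : SimplexCategory, B.obj (op n) × SimplexCategory.toTop.{u}.obj n) where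
  r x y := ∃ (k : SimplexCategory) (a : k ⟶ x.1) (b : k ⟶ y.1)
    (w : SimplexCategory.toTop.{u}.obj k), SimplexCategory.toTop.map a w = x.2.2 ∧
      SimplexCategory.toTop.map b w = y.2.2 ∧ B.map a.op x.2.1 = B.map b.op y.2.1
  iseqv :=
    { refl := fun x => ⟨x.1, 𝟙 _, 𝟙 _, x.2.2, toTop_map_id_apply _, toTop_map_id_apply _, rfl⟩
      symm := by
        rintro x y ⟨k, a, b, w, h1, h2, h3⟩
        exact ⟨k, b, a, w, h2, h1, h3.symm⟩
      trans := by
        rintro x y z ⟨k, a, b, w, h1, h2, h3⟩ ⟨k', a', b', w', h1', h2', h3'⟩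
        -- Both witnesses map to the middle simplex and hit the same point there, so they can be
        -- amalgamated over it.
        obtain ⟨l, p, q, v, rfl, rfl, h⟩ := exists_amalgamation b a' w w' (h2.trans h1'.symm)
        refine ⟨l, p ≫ a, q ≫ b', v, (toTop_map_comp_apply _ _ _).trans h1,
          (toTop_map_comp_apply _ _ _).trans h2', ?_⟩
        have e1 := congrArg (B.map p.op) h3
        have e2 := congrArg (B.map q.op) h3'
        rw [← Functor.map_comp_apply, ← Functor.map_comp_apply, ← op_comp, ← op_comp] at e1 e2
        rw [e1, h, e2] }

/-- The relation of `pointSetoid` already identifies a point with its image under any simplicial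
operator, so the passage to classes factors through `|B|`. Equal points of `|B|` therefore have
equal classes. -/
lemma charMap_eq {B : SSet.{u}} {m n : SimplexCategory} {σ : B.obj (op m)} {τ : B.obj (op n)}
    {t : SimplexCategory.toTop.{u}.obj m} {s : SimplexCategory.toTop.{u}.obj n}
    (h : charMap B σ t = charMap B τ s) :
    ∃ (k : SimplexCategory) (a : k ⟶ m) (b : k ⟶ n) (w : SimplexCategory.toTop.{u}.obj k),
      SimplexCategory.toTop.map a w = t ∧ SimplexCategory.toTop.map b w = s ∧
        B.map a.op σ = B.map b.op τ := by
  -- The indiscrete topology makes every map into the quotient continuous, so the universal property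
  -- of `|B|` applies to the bare set.
  let _ : TopologicalSpace (Quotient (pointSetoid B)) := ⊤
  obtain ⟨f, hf⟩ := exists_toTop_desc (B := B) (X := TopCat.of (Quotient (pointSetoid B)))
    (fun n σ => TopCat.ofHom ⟨fun t => Quotient.mk _ ⟨n, σ, t⟩, continuous_top⟩) (by
      intro m n α σ
      ext t
      exact Quotient.sound ⟨m, 𝟙 _, α, t, toTop_map_id_apply _, rfl, by simp⟩)
  have key : ∀ (n : SimplexCategory) (σ : B.obj (op n)) (t : SimplexCategory.toTop.{u}.obj n),
      f (charMap B σ t) = Quotient.mk (pointSetoid B) ⟨n, σ, t⟩ := fun n σ t =>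
    congrArg (fun h : SimplexCategory.toTop.obj n ⟶ TopCat.of (Quotient (pointSetoid B)) => h t)
      (hf n σ)
  exact Quotient.exact ((key m σ t).symm.trans ((congrArg f h).trans (key n τ s)))

lemma charMap_map_apply {B : SSet.{u}} {m n : SimplexCategory} (α : m ⟶ n) (σ : B.obj (op n))
    (t : SimplexCategory.toTop.{u}.obj m) :
    charMap B (B.map α.op σ) t = charMap B σ (SimplexCategory.toTop.map α t) := by
  rw [charMap_map]; rfl

lemma toTop_map_charMap {B C : SSet.{u}} (f : B ⟶ C) {n : SimplexCategory} (σ : B.obj (op n))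
    (t : SimplexCategory.toTop.{u}.obj n) :
    SSet.toTop.map f (charMap B σ t) = charMap C (f.app _ σ) t := by
  rw [← charMap_comp_map]; rfl

/-! ### Bijectivity of `|B × C| → |B| × |C|`. -/

section Prod

variable {B C : SSet.{u}}

/-- The simplex of a product with given components. -/
def prodSimplex {n : SimplexCategory} (σ : B.obj (op n)) (τ : C.obj (op n)) :
    (B ⊗ C).obj (op n) := ⟨σ, τ⟩

lemma toTop_map_fst_charMap {n : SimplexCategory} (σ : B.obj (op n)) (τ : C.obj (op n))
    (t : SimplexCategory.toTop.{u}.obj n) :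
    SSet.toTop.map (fst B C) (charMap _ (prodSimplex σ τ) t) = charMap B σ t :=
  toTop_map_charMap _ _ _

lemma toTop_map_snd_charMap {n : SimplexCategory} (σ : B.obj (op n)) (τ : C.obj (op n))
    (t : SimplexCategory.toTop.{u}.obj n) :
    SSet.toTop.map (snd B C) (charMap _ (prodSimplex σ τ) t) = charMap C τ t :=
  toTop_map_charMap _ _ _

/-- The two projections give separate witnesses of equality. Amalgamating them over the simplex of
`x` and then equalizing their maps to the simplex of `y` produces one witness valid in both
components. -/
lemma toTop_prod_ext {x y : SSet.toTop.obj (B ⊗ C)}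
    (h1 : SSet.toTop.map (fst B C) x = SSet.toTop.map (fst B C) y)
    (h2 : SSet.toTop.map (snd B C) x = SSet.toTop.map (snd B C) y) : x = y := by
  obtain ⟨m, ⟨σ, τ⟩, t, rfl⟩ := charMap_surjective _ x
  obtain ⟨n, ⟨σ', τ'⟩, s, rfl⟩ := charMap_surjective _ y
  obtain ⟨k, a, b, w, ha, hb, h1⟩ := charMap_eq
    ((toTop_map_fst_charMap σ τ t).symm.trans (h1.trans (toTop_map_fst_charMap σ' τ' s)))
  obtain ⟨k', a', b', w', ha', hb', h2⟩ := charMap_eq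
    ((toTop_map_snd_charMap σ τ t).symm.trans (h2.trans (toTop_map_snd_charMap σ' τ' s)))
  obtain ⟨l, p, q, v, rfl, rfl, h⟩ := exists_amalgamation a a' w w' (ha.trans ha'.symm)
  -- `p ≫ b` and `q ≫ b'` both send `v` to `s`, so they agree after restriction to the support of
  -- `v`.
  obtain ⟨j, e, u, rfl, he⟩ := exists_equalizing (p ≫ b) (q ≫ b') v (by
    rw [toTop_map_comp_apply, toTop_map_comp_apply, hb, hb'])
  have e1 := congrArg (B.map (e ≫ p).op) h1
  have e2 := congrArg (C.map (e ≫ q).op) h2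
  rw [← Functor.map_comp_apply, ← Functor.map_comp_apply, ← op_comp, ← op_comp] at e1 e2
  rw [Category.assoc, Category.assoc, ← h, ← he] at e2
  rw [Category.assoc, Category.assoc] at e1
  have e3 : (B ⊗ C).map (e ≫ p ≫ a).op (prodSimplex σ τ) =
      (B ⊗ C).map (e ≫ p ≫ b).op (prodSimplex σ' τ') := Prod.ext e1 e2
  have e4 := congrArg (fun ρ => charMap (B ⊗ C) ρ u) e3
  dsimp only at e4
  rw [charMap_map_apply, charMap_map_apply] at e4
  have e5 : SimplexCategory.toTop.map (e ≫ p ≫ a) u = t := by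
    rw [toTop_map_comp_apply, toTop_map_comp_apply, ha]
  have e6 : SimplexCategory.toTop.map (e ≫ p ≫ b) u = s := by
    rw [toTop_map_comp_apply, toTop_map_comp_apply, hb]
  rw [e5, e6] at e4
  exact e4

lemma exists_toTop_prod (x : SSet.toTop.obj B) (y : SSet.toTop.obj C) :
    ∃ z : SSet.toTop.obj (B ⊗ C),
      SSet.toTop.map (fst B C) z = x ∧ SSet.toTop.map (snd B C) z = y := by
  obtain ⟨m, σ, t, rfl⟩ := charMap_surjective _ x
  obtain ⟨n, τ, s, rfl⟩ := charMap_surjective _ y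
  obtain ⟨k, -, p, q, w, rfl, rfl⟩ := exists_common_simplex t s
  refine ⟨charMap _ (prodSimplex (B.map p.op σ) (C.map q.op τ)) w, ?_, ?_⟩
  · rw [toTop_map_fst_charMap, charMap_map_apply]
  · rw [toTop_map_snd_charMap, charMap_map_apply]

/-- The point of `|B × C|` with given components. -/
noncomputable def pair (x : SSet.toTop.obj B) (y : SSet.toTop.obj C) : SSet.toTop.obj (B ⊗ C) :=
  (exists_toTop_prod x y).choose

lemma fst_pair (x : SSet.toTop.obj B) (y : SSet.toTop.obj C) :
    SSet.toTop.map (fst B C) (pair x y) = x := (exists_toTop_prod x y).choose_spec.1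

lemma snd_pair (x : SSet.toTop.obj B) (y : SSet.toTop.obj C) :
    SSet.toTop.map (snd B C) (pair x y) = y := (exists_toTop_prod x y).choose_spec.2

lemma pair_charMap {k m n : SimplexCategory} (σ : B.obj (op m)) (τ : C.obj (op n))
    (p : k ⟶ m) (q : k ⟶ n) (w : SimplexCategory.toTop.{u}.obj k) :
    pair (charMap B σ (SimplexCategory.toTop.map p w))
      (charMap C τ (SimplexCategory.toTop.map q w)) =
    charMap (B ⊗ C) (prodSimplex (B.map p.op σ) (C.map q.op τ)) w := by
  refine toTop_prod_ext ?_ ?_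
  · rw [fst_pair, toTop_map_fst_charMap, charMap_map_apply]
  · rw [snd_pair, toTop_map_snd_charMap, charMap_map_apply]

lemma toTop_map_braiding_pair (x : SSet.toTop.obj B) (y : SSet.toTop.obj C) :
    SSet.toTop.map (β_ B C).hom (pair x y) = pair y x := by
  have h : ∀ {D : SSet.{u}} (f : C ⊗ B ⟶ D), SSet.toTop.map f (SSet.toTop.map (β_ B C).hom (pair x y)) =
      SSet.toTop.map ((β_ B C).hom ≫ f) (pair x y) := fun f => by
    rw [Functor.map_comp]; rfl
  refine toTop_prod_ext ?_ ?_
  · rw [h, fst_pair]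
    simp [snd_pair]
  · rw [h, snd_pair]
    simp [fst_pair]

end Prod

/-! ### Compact subsets of realizations and continuity of the pairing. -/

section Compact

/-- A compact subset of a realization is covered by finitely many simplices. -/
lemma exists_finite_cover_of_isCompact {B : SSet.{u}} {K : Set (SSet.toTop.obj B)}
    (hK : IsCompact K) : ∃ F : Set (Σ n : SimplexCategory, B.obj (op n)), F.Finite ∧
      K ⊆ ⋃ i ∈ F, Set.range (charMap B i.2) := by
  have hex : ∀ x : SSet.toTop.obj B, ∃ i : (Σ n : ℕ, B.obj (op (.mk n))),
      i.2 ∈ B.nonDegenerate i.1 ∧ ∃ t : SimplexCategory.toTop.{u}.obj (.mk i.1),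
        (∀ j, 0 < (coords t) j) ∧ charMap B i.2 t = x := fun x => by
    obtain ⟨n, σ, hσ, t, ht, h⟩ := exists_nonDegenerate_charMap x
    exact ⟨⟨n, σ⟩, hσ, t, ht, h⟩
  choose c hc ht using hex
  -- `c` picks a nondegenerate simplex with the point in its interior. For points of the simplex `ρ`
  -- this is always a face of `ρ`, leaving finitely many choices.
  have hfin : ∀ (n : SimplexCategory) (ρ : B.obj (op n)), (c '' Set.range (charMap B ρ)).Finite := by
    intro n ρ
    refine Set.Finite.subset (s := ⋃ k ∈ Finset.range (n.len + 1),
      Set.range fun f : SimplexCategory.mk k ⟶ n =>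
        (⟨k, B.map f.op ρ⟩ : Σ n : ℕ, B.obj (op (.mk n)))) ?_ ?_
    · exact Set.Finite.biUnion (Finset.finite_toSet _) fun k _ => Set.finite_range _
    · rintro _ ⟨_, ⟨s, rfl⟩, rfl⟩
      obtain ⟨t, ht, hts⟩ := ht (charMap B ρ s)
      have hnd := hc (charMap B ρ s)
      generalize c (charMap B ρ s) = i at *
      obtain ⟨m, σ⟩ := i
      obtain ⟨k, a, b, w, rfl, rfl, h⟩ := charMap_eq hts
      -- A vertex outside the range of `a` would have coordinate zero, against interiority.
      have ha : Function.Surjective a.toOrderHom := by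
        intro j
        by_contra! hj
        refine (ht j).ne' ?_
        refine (stdSimplex_map_apply (k := k.len) (n := m) a.toOrderHom w.down j).trans ?_
        exact Finset.sum_eq_zero fun l _ => if_neg (hj l)
      have : Epi a := SimplexCategory.epi_iff_surjective.2 ha
      have := isSplitEpi_of_epi a
      have hσ : B.map (section_ a ≫ b).op ρ = σ := by
        have := congrArg (B.map (section_ a).op) h
        rw [← Functor.map_comp_apply, ← Functor.map_comp_apply, ← op_comp, ← op_comp,
          IsSplitEpi.id] at this
        simpa using this.symm
      have := B.mono_of_nonDegenerate ⟨σ, hnd⟩ (section_ a ≫ b) ρ hσ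
      have hle := SimplexCategory.len_le_of_mono (section_ a ≫ b)
      simp only [Set.mem_iUnion]
      exact ⟨m, Finset.mem_coe.2 (Finset.mem_range.2 (Nat.lt_succ_of_le hle)),
        section_ a ≫ b, congrArg (Sigma.mk m) hσ⟩
  -- One point of `K` is selected in each open cell that `K` meets.
  choose x hxK hx using fun i : c '' K => i.2
  -- Every set of selected points meets each simplex in a finite set, hence is closed. The selected
  -- points thus form a compact discrete set, which is finite.
  have hclosed : ∀ S : Set (c '' K), IsClosed (x '' S) := by
    intro S
    rw [← isOpen_compl_iff]
    refine isOpen_of_charMap B _ fun n ρ => ?_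
    rw [Set.preimage_compl, isOpen_compl_iff]
    have hf : (x '' S ∩ Set.range (charMap B ρ)).Finite := by
      refine Set.Finite.of_finite_image (f := c) ((hfin n ρ).subset
        (Set.image_mono Set.inter_subset_right)) ?_
      rintro _ ⟨⟨i, -, rfl⟩, -⟩ _ ⟨⟨j, -, rfl⟩, -⟩ hij
      rw [hx, hx] at hij
      rw [Subtype.ext hij]
    have := hf.isClosed.preimage (charMap B ρ).hom.continuous
    rwa [Set.preimage_inter, Set.preimage_range, Set.inter_univ] at this
  have hSK : IsCompact (x '' Set.univ) := hK.of_isClosed_subset (hclosed _) (by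
    rintro _ ⟨i, -, rfl⟩; exact hxK i)
  have hdisc : DiscreteTopology (x '' Set.univ) := by
    refine discreteTopology_iff_forall_isClosed.2 fun S => ?_
    have : S = Subtype.val ⁻¹' (x '' (x ⁻¹' (Subtype.val '' S))) := by
      ext ⟨_, i, -, rfl⟩
      simp only [Set.mem_preimage, Set.mem_image]
      constructor
      · exact fun h => ⟨i, ⟨_, h, rfl⟩, rfl⟩
      · rintro ⟨j, ⟨y, hy, hy'⟩, hj⟩
        convert hy
        exact Subtype.ext (hj.symm.trans hy'.symm)
    rw [this]
    exact (hclosed _).preimage continuous_subtype_val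
  have hfinK : (c '' K).Finite := by
    have h1 := hSK.finite ⟨hdisc⟩
    have h2 : Function.Injective x := fun i j hij => Subtype.ext ((hx i).symm.trans
      ((congrArg c hij).trans (hx j)))
    have := Set.finite_univ_iff.1 (h1.of_finite_image h2.injOn)
    exact Set.toFinite _
  refine ⟨(fun i : Σ n : ℕ, B.obj (op (.mk n)) => ⟨.mk i.1, i.2⟩) '' (c '' K), hfinK.image _, ?_⟩
  intro y hy
  obtain ⟨t, -, h⟩ := ht y
  simp only [Set.mem_iUnion]
  exact ⟨⟨.mk (c y).1, (c y).2⟩, ⟨c y, ⟨y, hy, rfl⟩, rfl⟩, t, h⟩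

/-- All values lie in a finite union `L` of simplices. On the compact set `L` the map to the
Hausdorff space `|B| × |C|` is closed, and it is injective, so closed conditions on the pair become
closed conditions on `(f x, g x)`. The bound on the dimension of common simplices is what keeps `L`
a finite union. -/
lemma continuous_pair_of_compact {B C : SSet.{u}} {K : Type v} [TopologicalSpace K] [CompactSpace K]
    {f : K → SSet.toTop.obj B} {g : K → SSet.toTop.obj C} (hf : Continuous f) (hg : Continuous g) :
    Continuous fun x => pair (f x) (g x) := by
  obtain ⟨F, hF, hfF⟩ := exists_finite_cover_of_isCompact (isCompact_range hf)
  obtain ⟨G, hG, hgG⟩ := exists_finite_cover_of_isCompact (isCompact_range hg)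
  let L : Set (SSet.toTop.obj (B ⊗ C)) := ⋃ i ∈ F, ⋃ j ∈ G,
    ⋃ k ∈ Finset.range (i.1.len + j.1.len + 1), ⋃ (p : SimplexCategory.mk k ⟶ i.1),
      ⋃ (q : SimplexCategory.mk k ⟶ j.1), Set.range
        (charMap (B ⊗ C) (prodSimplex (B.map p.op i.2) (C.map q.op j.2)))
  have hL : IsCompact L := hF.isCompact_biUnion fun i _ => hG.isCompact_biUnion fun j _ =>
    Finset.isCompact_biUnion _ fun k _ => isCompact_iUnion fun p => isCompact_iUnion fun q =>
      isCompact_range (charMap (B ⊗ C) _).hom.continuous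
  have hmem : ∀ x, pair (f x) (g x) ∈ L := by
    intro x
    have h1 := hfF ⟨x, rfl⟩
    have h2 := hgG ⟨x, rfl⟩
    simp only [Set.mem_iUnion] at h1 h2
    obtain ⟨i, hi, t, ht⟩ := h1
    obtain ⟨j, hj, s, hs⟩ := h2
    obtain ⟨k, hk, p, q, w, rfl, rfl⟩ := exists_common_simplex t s
    simp only [L, Set.mem_iUnion]
    refine ⟨i, hi, j, hj, k, Finset.mem_range.2 (Nat.lt_succ_of_le hk), p, q, w, ?_⟩
    rw [← pair_charMap, ht, hs]
  refine continuous_iff_isClosed.2 fun Z hZ => ?_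
  let φ : SSet.toTop.obj (B ⊗ C) → SSet.toTop.obj B × SSet.toTop.obj C := fun z =>
    (SSet.toTop.map (fst B C) z, SSet.toTop.map (snd B C) z)
  have hφ : Continuous φ := (SSet.toTop.map (fst B C)).hom.continuous.prodMk
    (SSet.toTop.map (snd B C)).hom.continuous
  have : (fun x => pair (f x) (g x)) ⁻¹' Z = (fun x => (f x, g x)) ⁻¹' (φ '' (L ∩ Z)) := by
    ext x
    constructor
    · intro hx
      exact ⟨_, ⟨hmem x, hx⟩, Prod.ext (fst_pair _ _) (snd_pair _ _)⟩
    · rintro ⟨z, ⟨-, hz⟩, h⟩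
      have : pair (f x) (g x) = z := toTop_prod_ext
        ((fst_pair _ _).trans (congrArg Prod.fst h).symm)
        ((snd_pair _ _).trans (congrArg Prod.snd h).symm)
      change pair (f x) (g x) ∈ Z
      rwa [this]
  rw [this]
  exact ((hL.inter_right hZ).image hφ).isClosed.preimage (hf.prodMk hg)

lemma continuous_pair {B C : SSet.{u}} {X : Type u} [TopologicalSpace X]
    [CompactlyGeneratedSpace X] {f : X → SSet.toTop.obj B} {g : X → SSet.toTop.obj C}
    (hf : Continuous f) (hg : Continuous g) : Continuous fun x => pair (f x) (g x) :=
  continuous_from_compactlyGeneratedSpace _ fun _ _ _ _ _ h =>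
    continuous_pair_of_compact (hf.comp h) (hg.comp h)

/-- A tube lemma: the points `x` for which `{x} × N` lies in `U`, for `N` compact. -/
lemma isOpen_setOf_forall_pair {B C : SSet.{u}} {N : Type u} [TopologicalSpace N] [CompactSpace N]
    {φ : N → SSet.toTop.obj C} (hφ : Continuous φ) {U : Set (SSet.toTop.obj (B ⊗ C))}
    (hU : IsOpen U) : IsOpen {x : SSet.toTop.obj B | ∀ z, pair x (φ z) ∈ U} := by
  -- Openness is tested on compact Hausdorff probes `K`; there the complement is the projection of a
  -- closed subset of `K × N`, closed because `N` is compact.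
  refine CompactlyGeneratedSpace.isOpen' fun K _ _ _ f hf => ?_
  have h := continuous_pair_of_compact (K := K × N) (hf.comp continuous_fst)
    (hφ.comp continuous_snd)
  have h' := isClosedMap_fst_of_compactSpace _ (hU.preimage h).isClosed_compl
  rw [← isOpen_compl_iff] at h'
  convert h' using 1
  ext x
  simp

lemma isOpen_setOf_forall_pair' {B C : SSet.{u}} {N : Type u} [TopologicalSpace N] [CompactSpace N]
    {φ : N → SSet.toTop.obj B} (hφ : Continuous φ) {U : Set (SSet.toTop.obj (B ⊗ C))}
    (hU : IsOpen U) : IsOpen {y : SSet.toTop.obj C | ∀ z, pair (φ z) y ∈ U} := by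
  have := isOpen_setOf_forall_pair (B := C) (C := B) hφ
    (hU.preimage (SSet.toTop.map (β_ C B).hom).hom.continuous)
  convert this using 1
  ext y
  refine forall_congr' fun z => ?_
  rw [← toTop_map_braiding_pair]
  rfl

end Compact

end Realization

/-! ### Increasing segments in a simplex. -/

section Segment

/-- The circulation of the real line: `x ≤_U y` when `x ≤ y` and `[x, y] ⊆ U`. -/
def realCirculation : Circulation ℝ where
  rel U x y := x ≤ y ∧ Set.Icc x y ⊆ U
  mem h := ⟨h.2 (Set.left_mem_Icc.2 h.1), h.2 (Set.right_mem_Icc.2 h.1)⟩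
  refl hx := ⟨le_rfl, by simpa using hx⟩
  trans h h' := ⟨h.1.trans h'.1, fun _ hz => (le_total _ _).elim (fun h1 => h.2 ⟨hz.1, h1⟩)
    fun h1 => h'.2 ⟨h1, hz.2⟩⟩
  rel_sSup O x y := by
    constructor
    · rintro ⟨hxy, h⟩
      refine ⟨h (Set.left_mem_Icc.2 hxy), ?_⟩
      -- A Lebesgue subdivision of `[x, y]` has each piece inside one member of the cover.
      obtain ⟨t, h0, hmono, ⟨n, hn⟩, ht⟩ := exists_monotone_Icc_subset_open_cover_Icc hxy
        (c := fun U : O => (Subtype.val : Set.Icc x y → ℝ) ⁻¹' (U : Opens ℝ))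
        (fun U => U.1.isOpen.preimage continuous_subtype_val) (fun z _ => by
          have := h z.2
          simp only [Opens.coe_sSup, Set.mem_iUnion] at this
          obtain ⟨U, hU, hz⟩ := this
          exact Set.mem_iUnion.2 ⟨⟨U, hU⟩, hz⟩)
      have key : ∀ n, Relation.ReflTransGen
          (fun a b => ∃ U ∈ O, a ≤ b ∧ Set.Icc a b ⊆ (U : Set ℝ)) x (t n) := by
        intro n
        induction n with
        | zero => rw [h0]
        | succ n ih =>
          obtain ⟨U, hU⟩ := ht n
          refine ih.tail ⟨U, U.2, hmono n.le_succ, fun z hz => ?_⟩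
          exact hU (a := ⟨z, (t n).2.1.trans hz.1, hz.2.trans (t (n + 1)).2.2⟩) hz
      have := key n
      rwa [hn n le_rfl] at this
    · rintro ⟨hx, h⟩
      induction h with
      | refl => exact ⟨le_rfl, by simpa using hx⟩
      | tail _ h ih =>
        obtain ⟨U, hU, h⟩ := h
        have hle : U ≤ sSup O := le_sSup hU
        exact ⟨ih.1.trans h.1, fun _ hz => (le_total _ _).elim (fun h1 => ih.2 ⟨hz.1, h1⟩)
          fun h1 => hle (h.2 ⟨h1, hz.2⟩)⟩

/-- The point dividing the segment from `x` to `y` in a given ratio. -/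
def segmentPoint {n : ℕ} (x y : stdSimplex ℝ (Fin (n + 1))) (a : unitInterval) :
    stdSimplex ℝ (Fin (n + 1)) :=
  ⟨fun i => (1 - (a : ℝ)) * x i + a * y i,
    convex_stdSimplex ℝ _ x.2 y.2 (sub_nonneg.2 a.2.2) a.2.1 (by ring)⟩

lemma segmentPoint_apply {n : ℕ} (x y : stdSimplex ℝ (Fin (n + 1))) (a : unitInterval)
    (i : Fin (n + 1)) : segmentPoint x y a i = (1 - (a : ℝ)) * x i + a * y i := rfl

lemma segmentPoint_zero {n : ℕ} (x y : stdSimplex ℝ (Fin (n + 1))) : segmentPoint x y 0 = x := by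
  ext; simp [segmentPoint_apply]

lemma segmentPoint_one {n : ℕ} (x y : stdSimplex ℝ (Fin (n + 1))) : segmentPoint x y 1 = y := by
  ext; simp [segmentPoint_apply]

lemma headSum_segmentPoint {n : ℕ} (x y : stdSimplex ℝ (Fin (n + 1))) (a : unitInterval)
    (j : Fin (n + 1)) :
    headSum (segmentPoint x y a) j = (1 - (a : ℝ)) * headSum x j + a * headSum y j := by
  simp only [headSum, Finset.mul_sum, ← Finset.sum_add_distrib, segmentPoint_apply]
  refine Finset.sum_congr rfl fun i _ => ?_
  split_ifs <;> simp

lemma map_segmentPoint {k n : ℕ} (f : Fin (k + 1) → Fin (n + 1))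
    (x y : stdSimplex ℝ (Fin (k + 1))) (a : unitInterval) :
    stdSimplex.map f (segmentPoint x y a) =
      segmentPoint (stdSimplex.map f x) (stdSimplex.map f y) a := by
  ext j
  simp only [segmentPoint_apply, stdSimplex_map_apply, Finset.mul_sum, ← Finset.sum_add_distrib]
  refine Finset.sum_congr rfl fun i _ => ?_
  split_ifs <;> simp

lemma simplexLE_segmentPoint {n : ℕ} {x y : stdSimplex ℝ (Fin (n + 1))} (h : simplexLE x y)
    {a b : unitInterval} (hab : a ≤ b) : simplexLE (segmentPoint x y a) (segmentPoint x y b) := by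
  rw [simplexLE_iff_headSum] at h ⊢
  intro j
  rw [headSum_segmentPoint, headSum_segmentPoint]
  have hab : (a : ℝ) ≤ b := hab
  nlinarith [mul_nonneg (sub_nonneg.2 hab) (sub_nonneg.2 (h j))]

lemma continuous_segmentPoint {n : ℕ} (x y : stdSimplex ℝ (Fin (n + 1))) :
    Continuous (segmentPoint x y) := by
  refine Continuous.subtype_mk (continuous_pi fun i => ?_) _
  fun_prop

/-- Comparable points of a simplex are related over every open set containing their segment. -/
lemma simplexCirculation_rel_of_segment {n : ℕ} {x y : stdSimplex ℝ (Fin (n + 1))}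
    (h : simplexLE x y) {U : Opens (SimplexCategory.toTop.{u}.obj (.mk n))}
    (hU : ∀ a, (ULift.up (segmentPoint x y a) : SimplexCategory.toTop.{u}.obj (.mk n)) ∈ U) :
    (simplexCirculation.{u} (.mk n)).rel U (ULift.up x) (ULift.up y) := by
  let f : C(ℝ, SimplexCategory.toTop.{u}.obj (.mk n)) :=
    ⟨fun r => ULift.up (segmentPoint x y (Set.projIcc 0 1 zero_le_one r)),
      continuous_uliftUp.comp ((continuous_segmentPoint x y).comp continuous_projIcc)⟩
  have h0 : f 0 = ULift.up x := congrArg ULift.up ((congrArg (segmentPoint x y)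
    (Set.projIcc_left (h := zero_le_one' ℝ))).trans (segmentPoint_zero x y))
  have h1 : f 1 = ULift.up y := congrArg ULift.up ((congrArg (segmentPoint x y)
    (Set.projIcc_right (h := zero_le_one' ℝ))).trans (segmentPoint_one x y))
  suffices key : (simplexCirculation.{u} (.mk n)).rel U (f 0) (f 1) by rwa [h0, h1] at key
  -- The circulation of the line, pushed forward along the segment, has global preorder inside
  -- `simplexLE`; the circulation of the simplex is the largest such one, so it contains every
  -- relation along the segment.
  refine Circulation.le_ofPreorder _
    (Circulation.final (ι := Unit) (fun _ => realCirculation) (fun _ => f)) ?_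
    (Circulation.final_step (ι := Unit) (fun _ => realCirculation) (fun _ => f) ()
      ⟨zero_le_one, fun _ _ => hU _⟩)
  rintro a b ⟨-, hab⟩
  induction hab with
  | refl => exact fun _ => le_rfl
  | tail _ h' ih =>
    obtain ⟨_, p, q, h', rfl, rfl⟩ := h'
    exact fun j => (ih j).trans (simplexLE_segmentPoint h (Set.monotone_projIcc _ h'.1) j)

end Segment

/-! ### Slices and pairings as stream maps. -/

namespace Realization

open MonoidalCategory CartesianMonoidalCategory

variable {B C : SSet.{u}}

/-- Moving along an increasing segment in the first coordinate. -/
lemma rel_pair_of_convex {m n : ℕ} (σ : B.obj (op (.mk m))) (τ : C.obj (op (.mk n)))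
    (s : stdSimplex ℝ (Fin (n + 1))) (U : Opens (SSet.toTop.obj (B ⊗ C)))
    (V : Set (stdSimplex ℝ (Fin (m + 1)))) (hV : ∀ x ∈ V, ∀ y ∈ V, ∀ a, segmentPoint x y a ∈ V)
    (hVU : ∀ x ∈ V, pair (charMap B σ (ULift.up x)) (charMap C τ (ULift.up s)) ∈ U) (N : ℕ) :
    ∀ (t t' : stdSimplex ℝ (Fin (m + 1))), t ∈ V → t' ∈ V → simplexLE t t' →
      (Finset.univ.filter fun ij : Fin (m + 1) × Fin (n + 1) =>
        headSum t' ij.1 < headSum s ij.2 ∧ headSum s ij.2 < headSum t ij.1).card = N →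
      (realizationCirculation (B ⊗ C)).rel U
        (pair (charMap B σ (ULift.up t)) (charMap C τ (ULift.up s)))
        (pair (charMap B σ (ULift.up t')) (charMap C τ (ULift.up s))) := by
  -- `N` counts the walls strictly crossed between `t` and `t'`. With none, both endpoints lie in
  -- one closed cell; otherwise the segment is cut at a wall.
  induction N using Nat.strong_induction_on with
  | _ N ih =>
  intro t t' ht ht' hle hN
  have hle' := (simplexLE_iff_headSum _ _).1 hle
  rcases Finset.eq_empty_or_nonempty (Finset.univ.filter
    fun ij : Fin (m + 1) × Fin (n + 1) =>
      headSum t' ij.1 < headSum s ij.2 ∧ headSum s ij.2 < headSum t ij.1) with h0 | ⟨⟨i, j⟩, hij⟩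
  · obtain ⟨k, -, p, q, w, w', hp, hp', hq, hq', hw⟩ := exists_refinement_pair t t' s s hle
      (fun _ => le_rfl) fun i j => by
        by_cases h : headSum s j ≤ headSum t' i
        · exact .inr ⟨h.trans (hle' i), h⟩
        · left
          rw [not_le] at h
          have : (i, j) ∉ (Finset.univ.filter fun ij : Fin (m + 1) × Fin (n + 1) =>
            headSum t' ij.1 < headSum s ij.2 ∧ headSum s ij.2 < headSum t ij.1) := by simp [h0]
          simp only [Finset.mem_filter, Finset.mem_univ, true_and, not_and, not_lt] at this
          exact ⟨this h, h.le⟩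
    have key : ∀ (t : stdSimplex ℝ (Fin (m + 1))) (w : stdSimplex ℝ (Fin (k + 1)))
        (_ : stdSimplex.map p w = t) (_ : stdSimplex.map q w = s),
        pair (charMap B σ (ULift.up t)) (charMap C τ (ULift.up s)) =
          charMap (B ⊗ C) (prodSimplex (B.map (SimplexCategory.mkHom p).op σ)
            (C.map (SimplexCategory.mkHom q).op τ)) (ULift.up w) := by
      rintro t w rfl rfl
      exact pair_charMap σ τ (SimplexCategory.mkHom p) (SimplexCategory.mkHom q) (ULift.up w)
    rw [key t w hp hq, key t' w' hp' hq']
    refine Circulation.final_step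
      (ι := Σ n : SimplexCategory, (B ⊗ C).obj (op n)) (fun i => simplexCirculation i.1)
      (fun i => (charMap (B ⊗ C) i.2).hom) ⟨.mk k, _⟩ (simplexCirculation_rel_of_segment hw ?_)
    intro a
    -- The segment from `w` to `w'` projects to the segment from `t` to `t'` and to the constant
    -- `s`, so convexity of `V` keeps it over `U`.
    have h := hVU _ (hV _ ht _ ht' a)
    rw [key _ (segmentPoint w w' a) (by rw [map_segmentPoint, hp, hp'])
      (by rw [map_segmentPoint, hq, hq']; ext; rw [segmentPoint_apply]; ring)] at h
    exact h
  · have hij' := (Finset.mem_filter.1 hij).2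
    dsimp only at hij'
    have hlt := hij'.1.trans hij'.2
    have hd : 0 < headSum t i - headSum t' i := sub_pos.2 hlt
    -- The partial sum at `i` is affine along the segment; this parameter is where it equals
    -- `headSum s j`. Neither half strictly crosses the wall `(i, j)`, and neither crosses a new
    -- one.
    let a : unitInterval := ⟨(headSum t i - headSum s j) / (headSum t i - headSum t' i),
      div_nonneg (by linarith) hd.le, (div_le_one hd).2 (by linarith)⟩
    have ha : headSum (segmentPoint t t' a) i = headSum s j := by
      rw [headSum_segmentPoint]
      have : (a : ℝ) * (headSum t i - headSum t' i) = headSum t i - headSum s j :=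
        div_mul_cancel₀ _ hd.ne'
      linarith
    have hl : simplexLE t (segmentPoint t t' a) := by
      have := simplexLE_segmentPoint hle (show 0 ≤ a from a.2.1)
      rwa [segmentPoint_zero] at this
    have hr : simplexLE (segmentPoint t t' a) t' := by
      have := simplexLE_segmentPoint hle (show a ≤ 1 from a.2.2)
      rwa [segmentPoint_one] at this
    have hl' := (simplexLE_iff_headSum _ _).1 hl
    have hr' := (simplexLE_iff_headSum _ _).1 hr
    refine Circulation.trans _ (ih _ ?_ t (segmentPoint t t' a) ht (hV _ ht _ ht' _) hl rfl)
      (ih _ ?_ (segmentPoint t t' a) t' (hV _ ht _ ht' _) ht' hr rfl)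
    · rw [← hN]
      refine Finset.card_lt_card (Finset.ssubset_iff_of_subset (fun x hx => ?_) |>.2
        ⟨(i, j), hij, by simp [ha]⟩)
      simp only [Finset.mem_filter, Finset.mem_univ, true_and] at hx ⊢
      exact ⟨(hr' _).trans_lt hx.1, hx.2⟩
    · rw [← hN]
      refine Finset.card_lt_card (Finset.ssubset_iff_of_subset (fun x hx => ?_) |>.2
        ⟨(i, j), hij, by simp [ha]⟩)
      simp only [Finset.mem_filter, Finset.mem_univ, true_and] at hx ⊢
      exact ⟨hx.1, hx.2.trans_le (hl' _)⟩

/-- The inclusion `|B| × {y} → |B × C|` of a slice. -/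
noncomputable def slice (y : SSet.toTop.obj C) : C(SSet.toTop.obj B, SSet.toTop.obj (B ⊗ C)) :=
  ⟨fun x => pair x y, continuous_pair continuous_id continuous_const⟩

/-- Small balls in a simplex are convex, so inside the preimage of `U` order-comparable points of a
ball are related by their segment. These balls cover the preimage, and the gluing axiom splits any
relation there into such local steps. -/
lemma isStreamMap_slice (y : SSet.toTop.obj C) :
    Circulation.IsStreamMap (realizationCirculation B) (realizationCirculation (B ⊗ C))
      (slice y) := by
  rw [isStreamMap_realization_iff]
  intro m σ U t t' h
  obtain ⟨n, τ, ⟨s⟩, rfl⟩ := charMap_surjective _ y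
  set f := (slice (charMap C τ ⟨s⟩)).comp (charMap B σ).hom
  let O : Set (Opens (SimplexCategory.toTop.{u}.obj m)) := {W | ∀ x ∈ W, ∀ y ∈ W,
    simplexLE x.down y.down → (realizationCirculation (B ⊗ C)).rel U (f x) (f y)}
  have hO : U.comap f ≤ sSup O := by
    intro x hx
    rw [Opens.mem_sSup]
    have hopen : IsOpen ((ULift.up : stdSimplex ℝ (Fin (m.len + 1)) →
        SimplexCategory.toTop.{u}.obj m) ⁻¹' (f ⁻¹' U)) :=
      (U.isOpen.preimage f.continuous).preimage continuous_uliftUp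
    let x' : stdSimplex ℝ (Fin (m.len + 1)) := x.down
    have hnhds := hopen.mem_nhds (x := x') hx
    obtain ⟨ε, hε, hball⟩ := Metric.mem_nhds_iff.1 hnhds
    let S : Set (stdSimplex ℝ (Fin (m.len + 1))) := Metric.ball x' ε
    have hS : IsOpen S := Metric.isOpen_ball
    refine ⟨⟨ULift.down ⁻¹' S, hS.preimage continuous_uliftDown⟩,
      ?_, Metric.mem_ball_self hε⟩
    rintro ⟨y⟩ hy ⟨z⟩ hz hle
    refine rel_pair_of_convex (m := m.len) (n := n.len) σ τ s U S ?_
      (fun w hw => hball hw) _ y z hy hz hle rfl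
    intro v hv w hw a
    exact (convex_ball (x' : Fin (m.len + 1) → ℝ) ε) hv hw (sub_nonneg.2 a.2.2) a.2.1 (by ring)
  have h' := Circulation.rel_mono _ hO h
  rw [Circulation.rel_sSup] at h'
  have hmem := (Circulation.mem _ h).1
  obtain ⟨-, h'⟩ := h'
  clear h
  induction h' with
  | refl => exact Circulation.refl _ hmem
  | tail _ hab ih =>
    obtain ⟨W, hW, hab⟩ := hab
    have hm := Circulation.mem _ hab
    exact Circulation.trans _ ih (hW _ hm.1 _ hm.2 (Circulation.rel_ofPreorder
      (fun x y : SimplexCategory.toTop.{u}.obj m => simplexLE x.down y.down)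
      (fun _ _ => le_rfl) (fun _ _ _ h h' j => (h j).trans (h' j))
      (Circulation.rel_mono _ le_top hab)))

/-- The inclusion `{x} × |C| → |B × C|` of a slice. -/
noncomputable def slice' (x : SSet.toTop.obj B) : C(SSet.toTop.obj C, SSet.toTop.obj (B ⊗ C)) :=
  ⟨fun y => pair x y, continuous_pair continuous_const continuous_id⟩

lemma isStreamMap_slice' (x : SSet.toTop.obj B) :
    Circulation.IsStreamMap (realizationCirculation C) (realizationCirculation (B ⊗ C))
      (slice' x) := by
  have h : slice' x = (SSet.toTop.map (β_ C B).hom).hom.comp (slice (B := C) x) := by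
    ext y
    exact (toTop_map_braiding_pair y x).symm
  rw [h]
  exact (isStreamMap_toTop_map _).comp (isStreamMap_slice x)

/-- Stream maps into `|B|` and `|C|` define a stream map into `|B × C|`. -/
lemma isStreamMap_pair {X : Type u} [TopologicalSpace X] [CompactlyGeneratedSpace X]
    (c : Circulation X) (hc : c.IsKCirculation) {f : C(X, SSet.toTop.obj B)}
    {g : C(X, SSet.toTop.obj C)} (hf : Circulation.IsStreamMap c (realizationCirculation B) f)
    (hg : Circulation.IsStreamMap c (realizationCirculation C) g) :
    Circulation.IsStreamMap c (realizationCirculation (B ⊗ C))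
      ⟨fun x => pair (f x) (g x), continuous_pair f.continuous g.continuous⟩ := by
  intro U x x' hxx'
  -- This is where the k-circulation condition enters: `K` is locally compact, while `X` need not
  -- be.
  obtain ⟨K, hK, _, hKU, hx, hx', d, hd, hdc⟩ := hc _ _ _ hxx'
  have : CompactSpace K := isCompact_iff_compactSpace.1 hK
  let O : Set (Opens K) := {V | ∀ a b : K, d.rel V a b →
    (realizationCirculation (B ⊗ C)).rel U (pair (f a) (g a)) (pair (f b) (g b))}
  have hO : (⊤ : Opens K) ≤ sSup O := by
    intro z _
    rw [Opens.mem_sSup]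
    have hcf : Continuous fun a : K => f a := f.continuous.comp continuous_subtype_val
    have hcg : Continuous fun a : K => g a := g.continuous.comp continuous_subtype_val
    -- The box around `z` is built in two stages: first `M` with `{f z} × g(M)` inside `U`, then, by
    -- the tube lemma, `M'` with `f(M') × g(M)` inside `U`.
    obtain ⟨M, hM, hzM, hMU⟩ := exists_compact_subset
      (U.isOpen.preimage (continuous_pair_of_compact (K := K)
        (continuous_const (y := f z)) hcg)) (x := z) (hKU z.2)
    have : CompactSpace M := isCompact_iff_compactSpace.1 hM
    let W : Opens (SSet.toTop.obj B) := ⟨_, isOpen_setOf_forall_pair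
      (hcg.comp (continuous_subtype_val (p := (· ∈ M)))) U.isOpen⟩
    obtain ⟨M', hM', hzM', hMW⟩ := exists_compact_subset (W.isOpen.preimage hcf) (x := z)
      fun a => hMU a.2
    have : CompactSpace M' := isCompact_iff_compactSpace.1 hM'
    let W' : Opens (SSet.toTop.obj C) := ⟨_, isOpen_setOf_forall_pair'
      (hcf.comp (continuous_subtype_val (p := (· ∈ M')))) U.isOpen⟩
    have hW : ∀ a ∈ M', ∀ b ∈ M, pair (f a) (g b) ∈ U := fun a ha b hb => hMW ha ⟨b, hb⟩
    refine ⟨⟨interior M ∩ interior M', isOpen_interior.inter isOpen_interior⟩, ?_, hzM, hzM'⟩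
    intro a b hab
    obtain ⟨ha, hb⟩ := d.mem hab
    have hfab : (realizationCirculation B).rel W (f a) (f b) := by
      refine hf W a b (hdc (W.comap f) a b (d.rel_mono ?_ hab))
      exact fun y hy => hMW (interior_subset hy.2)
    have hgab : (realizationCirculation C).rel W' (g a) (g b) := by
      refine hg W' a b (hdc (W'.comap g) a b (d.rel_mono ?_ hab))
      exact fun y hy e => hW e e.2 y (interior_subset hy.1)
    -- Pass from `(f a, g a)` to `(f b, g a)` and then to `(f b, g b)`. The sets `W` and `W'` lie in
    -- the preimages of `U` under these two slices because `a ∈ M` and `b ∈ M'`.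
    refine Circulation.trans _ (isStreamMap_slice (g a) U _ _ (Circulation.rel_mono _ ?_ hfab))
      (isStreamMap_slice' (f b) U _ _ (Circulation.rel_mono _ ?_ hgab))
    · exact fun y hy => hy ⟨a, interior_subset ha.1⟩
    · exact fun y hy => hy ⟨b, interior_subset hb.2⟩
  have hd' := d.rel_mono hO hd
  rw [Circulation.rel_sSup] at hd'
  have key : ∀ y : K, Relation.ReflTransGen (fun a b => ∃ V ∈ O, d.rel V a b) ⟨x, hx⟩ y →
      (realizationCirculation (B ⊗ C)).rel U (pair (f x) (g x)) (pair (f y) (g y)) := by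
    intro y h
    induction h with
    | refl => exact Circulation.refl _ (hKU hx)
    | tail _ hab ih =>
      obtain ⟨V, hV, hab⟩ := hab
      exact Circulation.trans _ ih (hV _ _ hab)
  exact key _ hd'.2

end Realization

/-! ### Binary products and the terminal object. -/

open MonoidalCategory CartesianMonoidalCategory Limits Realization

/-- The stream realization of a product, as a product of streams. -/
noncomputable def isLimitStreamRealizationProd (B C : SSet.{u}) :
    IsLimit (BinaryFan.mk (streamRealization.map (fst B C)) (streamRealization.map (snd B C))) :=
  BinaryFan.isLimitMk
    (fun s => ⟨⟨fun x => pair (s.fst.toContinuousMap x) (s.snd.toContinuousMap x),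
        continuous_pair s.fst.toContinuousMap.continuous s.snd.toContinuousMap.continuous⟩,
      isStreamMap_pair s.pt.circulation s.pt.isKCirculation s.fst.isStreamMap s.snd.isStreamMap⟩)
    (fun _ => StreamCat.Hom.ext (ContinuousMap.ext fun _ => fst_pair _ _))
    (fun _ => StreamCat.Hom.ext (ContinuousMap.ext fun _ => snd_pair _ _))
    (fun _ _ h1 h2 => StreamCat.Hom.ext (ContinuousMap.ext fun x => toTop_prod_ext
      ((congrArg (fun f => StreamCat.Hom.toContinuousMap f x) h1).trans (fst_pair _ _).symm)
      ((congrArg (fun f => StreamCat.Hom.toContinuousMap f x) h2).trans (snd_pair _ _).symm)))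

instance : PreservesLimitsOfShape (Discrete WalkingPair) streamRealization.{u} := by
  have (B C : SSet.{u}) : PreservesLimit (Limits.pair B C) streamRealization.{u} :=
    preservesLimit_of_preserves_limit_cone (tensorProductIsBinaryProduct B C)
      ((isLimitMapConeBinaryFanEquiv _ _ _).symm (isLimitStreamRealizationProd B C))
  exact ⟨fun {K} => preservesLimit_of_iso_diagram _ (diagramIsoPair K).symm⟩

noncomputable instance : Unique (SSet.toTop.obj (𝟙_ SSet.{u})) where
  default := charMap (𝟙_ SSet.{u}) (n := .mk 0) PUnit.unit (ULift.up (stdSimplex.vertex 0))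
  uniq x := by
    obtain ⟨n, ⟨⟩, t, rfl⟩ := charMap_surjective _ x
    -- Each simplex of the point is the degeneracy of its unique vertex, and `|Δ[0]|` has a single
    -- point.
    have h : SimplexCategory.toTop.map (SimplexCategory.const n (.mk 0) 0) t =
        ULift.up (stdSimplex.vertex 0) := by
      apply ULift.down_injective
      have : Subsingleton (stdSimplex ℝ (Fin (0 + 1))) :=
        inferInstanceAs (Subsingleton (stdSimplex ℝ (Fin 1)))
      exact Subsingleton.elim (α := stdSimplex ℝ (Fin (0 + 1))) _ _
    exact (charMap_map_apply (B := 𝟙_ SSet.{u}) (SimplexCategory.const n (.mk 0) 0)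
      PUnit.unit t).trans (congrArg _ h)

/-- The stream realization of the point is terminal. -/
noncomputable def isTerminalStreamRealizationUnit :
    IsTerminal (streamRealization.obj (𝟙_ SSet.{u})) :=
  IsTerminal.ofUniqueHom
    (fun X => ⟨⟨fun _ => (default : SSet.toTop.obj (𝟙_ SSet.{u})), continuous_const⟩,
      fun _ _ _ h => Circulation.refl _ (X.circulation.mem h).1⟩)
    fun _ _ => StreamCat.Hom.ext (ContinuousMap.ext fun _ =>
      Unique.eq_default (α := SSet.toTop.obj (𝟙_ SSet.{u})) _)

theorem mainTheorem8 :
    CategoryTheory.Limits.PreservesFiniteProducts streamRealization.{u} := by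
  have : PreservesLimit (Functor.empty.{0} SSet.{u}) streamRealization.{u} :=
    preservesLimit_of_preserves_limit_cone (isTerminalTensorUnit (C := SSet.{u}))
      ((isLimitMapConeEmptyConeEquiv _ _).symm isTerminalStreamRealizationUnit)
  have : PreservesLimitsOfShape (Discrete PEmpty.{1}) streamRealization.{u} :=
    preservesLimitsOfShape_pempty_of_preservesTerminal _
  exact .of_preserves_binary_and_terminal _
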